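/- **Proposition 5.1.** Let $k$ be a field and let $A$ and $B$ be finite dimensional associative $k$-algebras with identity which are singularly equivalent of Morita type with level. Then $A$ is syzygy-finite if and only if $B$ is syzygy-finite, and $A$ is Igusa–Todorov if and only if $B$ is Igusa–Todorov. Here modules are left modules, $k$ acts centrally on bimodules, and $A^e=A\otimes_k A^{op}$, so that $A$-$A$-bimodules are left $A^e$-modules. For a finitely generated module $X$ and $n\ge 0$, an $n$-th syzygy of $X$ is a module $K$ for which there is an exact sequence $0\to K\to P_{n-1}\to\cdots\to P_0\to X\to 0$ with all $P_i$ finitely generated projective (for $n=0$: $K\cong X$). It is unique up to projective direct summands, and its class in the stable category of finitely generated modules (modulo the maps factoring through finitely generated projective modules) is denoted $\Omega^n(X)$. * $A$ and $B$ are *singularly equivalent of Morita type with level* if, for some $n\ge 0$, there are an $A$-$B$-bimodule $M$ and a $B$-$A$-bimodule $N$ such that ${}_AM$, $M_B$, ${}_BN$, $N_A$ are finitely generated projective, and $M\otimes_B N\cong\Omega^n_{A^e}(A)$ and $N\otimes_A M\cong\Omega^n_{B^e}(B)$ in the stable categories of finitely generated $A^e$-modules and $B^e$-modules, respectively. * $A$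 is *syzygy-finite* if there is an integer $s\ge 0$ such that the class of all $n$-th syzygies, $n>s$, of finitely generated $A$-modules is representation-finite, i.e. up to isomorphism only finitely many indecomposable modules occur as direct summands of modules in this class. * $A$ is *Igusa–Todorov* if there are a finitely generated $A$-module $V$ and an integer $n\ge 0$ such that for every $n$-th syzygy $K$ of a finitely generated $A$-module there is an exact sequence $0\to V_1\to V_0\to K\to 0$ in which $V_1$ and $V_0$ are direct summands of finite direct sums of copies of $V$. -/

import Mathlib

universe u

open scoped TensorProduct

namespace SingularMorita

/-! ### Finitely generated modules, summands, indecomposables, syzygies -/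

section Modules

variable (R : Type u) [Ring R]

/-- `X` is isomorphic to a direct summand of `Y`. -/
def IsDirectSummand (X Y : Type u) [AddCommGroup X] [Module R X] [AddCommGroup Y] [Module R Y] :
    Prop :=
  ∃ (i : X →ₗ[R] Y) (r : Y →ₗ[R] X), r ∘ₗ i = LinearMap.id

/-- `X` belongs to `add V`: it is a direct summand of a finite direct sum of copies of `V`. -/
def IsInAdd (X V : Type u) [AddCommGroup X] [Module R X] [AddCommGroup V] [Module R V] : Prop :=
  ∃ r : ℕ, IsDirectSummand R X (Fin r → V)

/-- `X` is indecomposable: nonzero, and not the direct sum of two nonzero submodules. -/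
def IsIndecomposable (X : Type u) [AddCommGroup X] [Module R X] : Prop :=
  Nontrivial X ∧ ∀ p q : Submodule R X, IsCompl p q → p = ⊥ ∨ q = ⊥

variable {R} in
/-- The map `f` factors through a finitely generated projective module, that is,
it becomes zero in the stable category of finitely generated modules. -/
def FactorsThroughProjective {X Y : Type u} [AddCommGroup X] [Module R X]
    [AddCommGroup Y] [Module R Y] (f : X →ₗ[R] Y) : Prop :=
  ∃ (P : ModuleCat.{u} R) (g : X →ₗ[R] P) (h : P →ₗ[R] Y),
    Module.Finite R P ∧ Module.Projective R P ∧ f = h ∘ₗ g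

/-- `X` and `Y` are isomorphic in the stable category of `R`-modules, whose morphisms are the
`R`-linear maps modulo those that factor through a finitely generated projective module. -/
def StablyIsomorphic (X Y : Type u) [AddCommGroup X] [Module R X]
    [AddCommGroup Y] [Module R Y] : Prop :=
  ∃ (f : X →ₗ[R] Y) (g : Y →ₗ[R] X),
    FactorsThroughProjective (g ∘ₗ f - LinearMap.id) ∧
    FactorsThroughProjective (f ∘ₗ g - LinearMap.id)

/-- `IsSyzygy R n X K`: the module `K` is an `n`-th syzygy of `X`, i.e. there is an exact sequence
`0 → K → Pₙ₋₁ → ⋯ → P₀ → X → 0` with all `Pᵢ` finitely generated projective (for `n = 0`,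
`K ≅ X`). Up to projective direct summands `K` is unique. -/
def IsSyzygy : ℕ → ModuleCat.{u} R → ModuleCat.{u} R → Prop
  | 0, X, K => Nonempty (K ≃ₗ[R] X)
  | n + 1, X, K => ∃ (Y P : ModuleCat.{u} R) (f : K →ₗ[R] P) (g : P →ₗ[R] Y),
      IsSyzygy n X Y ∧ Module.Finite R P ∧ Module.Projective R P ∧
      Function.Injective f ∧ Function.Exact f g ∧ Function.Surjective g

/-- A class `C` of modules is representation-finite: up to isomorphism, only finitely many
finitely generated indecomposable modules occur as direct summands of modules in `C`. -/
def IsRepresentationFinite (C : ModuleCat.{u} R → Prop) : Prop :=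
  ∃ (r : ℕ) (L : Fin r → ModuleCat.{u} R), ∀ X : ModuleCat.{u} R,
    Module.Finite R X → IsIndecomposable R X → (∃ K, C K ∧ IsDirectSummand R X K) →
      ∃ i, Nonempty (X ≃ₗ[R] L i)

/-- `R` is syzygy-finite: for some `s`, the class of all `n`-th syzygies with `n > s` of finitely
generated modules is representation-finite. -/
def IsSyzygyFinite : Prop :=
  ∃ s : ℕ, IsRepresentationFinite R fun K =>
    ∃ (n : ℕ) (X : ModuleCat.{u} R), s < n ∧ Module.Finite R X ∧ IsSyzygy R n X K

/-- `R` is Igusa-Todorov: there are a finitely generated module `V` and an `n` such that every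
`n`-th syzygy `K` of a finitely generated module admits an exact sequence
`0 → V₁ → V₀ → K → 0` with `V₁, V₀ ∈ add V`. -/
def IsIgusaTodorov : Prop :=
  ∃ (V : ModuleCat.{u} R) (n : ℕ), Module.Finite R V ∧
    ∀ X K : ModuleCat.{u} R, Module.Finite R X → IsSyzygy R n X K →
      ∃ (V₁ V₀ : ModuleCat.{u} R) (f : V₁ →ₗ[R] V₀) (g : V₀ →ₗ[R] K),
        IsInAdd R V₁ V ∧ IsInAdd R V₀ V ∧
        Function.Injective f ∧ Function.Exact f g ∧ Function.Surjective g

end Modules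

/-! ### Tensor product of bimodules over a noncommutative algebra

An `A`-`B`-bimodule (with `k` acting centrally) is a `k`-module `M` with commuting actions of `A`
and of `Bᵐᵒᵖ` that both extend the action of `k`. -/

section Tensor

variable (k : Type u) [Field k] (A B C : Type u) [Ring A] [Algebra k A] [Ring B]
  [Ring C] [Algebra k C]
  (M N : Type u)
  [AddCommGroup M] [Module k M] [Module A M] [Module Bᵐᵒᵖ M]
  [IsScalarTower k A M] [SMulCommClass A Bᵐᵒᵖ M]
  [AddCommGroup N] [Module k N] [Module B N] [Module Cᵐᵒᵖ N]
  [IsScalarTower k Cᵐᵒᵖ N] [SMulCommClass B Cᵐᵒᵖ N]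

/-- The relations `mb ⊗ n = m ⊗ bn`. -/
def balancedRel (k : Type u) [Field k] (B : Type u) [Ring B] (M N : Type u)
    [AddCommGroup M] [Module k M] [Module Bᵐᵒᵖ M] [AddCommGroup N] [Module k N] [Module B N] :
    Submodule k (M ⊗[k] N) :=
  Submodule.span k {x | ∃ (b : B) (m : M) (n : N),
    x = (MulOpposite.op b • m) ⊗ₜ[k] n - m ⊗ₜ[k] (b • n)}

/-- The tensor product `M ⊗_B N` of a right `B`-module and a left `B`-module. -/
abbrev TensorOver (k : Type u) [Field k] (B : Type u) [Ring B] (M N : Type u)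
    [AddCommGroup M] [Module k M] [Module Bᵐᵒᵖ M] [AddCommGroup N] [Module k N] [Module B N] :
    Type u :=
  (M ⊗[k] N) ⧸ balancedRel k B M N

/-- The left action `a (m ⊗ n) = am ⊗ n` of `A` on `M ⊗_B N`. -/
def leftAction : A →ₐ[k] Module.End k (TensorOver k B M N) where
  toFun a := (balancedRel k B M N).mapQ (balancedRel k B M N)
    ((Algebra.lsmul k k M a).rTensor N) (by
      refine Submodule.span_le.2 ?_
      rintro _ ⟨b, m, n, rfl⟩
      refine Submodule.subset_span ⟨b, a • m, n, ?_⟩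
      simp [smul_comm a (MulOpposite.op b) m])
  map_one' := by
    ext m n
    exact congrArg (Submodule.Quotient.mk (p := balancedRel k B M N))
      (show ((1 : A) • m) ⊗ₜ[k] n = m ⊗ₜ[k] n by rw [one_smul])
  map_mul' a b := by
    ext m n
    exact congrArg (Submodule.Quotient.mk (p := balancedRel k B M N))
      (show ((a * b) • m) ⊗ₜ[k] n = (a • b • m) ⊗ₜ[k] n by rw [mul_smul])
  map_zero' := by
    ext m n
    exact congrArg (Submodule.Quotient.mk (p := balancedRel k B M N))
      (show ((0 : A) • m) ⊗ₜ[k] n = (0 : M ⊗[k] N) by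
        rw [zero_smul, TensorProduct.zero_tmul])
  map_add' a b := by
    ext m n
    exact congrArg (Submodule.Quotient.mk (p := balancedRel k B M N))
      (show ((a + b) • m) ⊗ₜ[k] n = (a • m) ⊗ₜ[k] n + (b • m) ⊗ₜ[k] n by
        rw [add_smul, TensorProduct.add_tmul])
  commutes' c := by
    ext m n
    exact congrArg (Submodule.Quotient.mk (p := balancedRel k B M N))
      (show (algebraMap k A c • m) ⊗ₜ[k] n = c • m ⊗ₜ[k] n by
        rw [algebraMap_smul, TensorProduct.smul_tmul'])

/-- The right action `(m ⊗ n) c = m ⊗ nc` of `C` on `M ⊗_B N`. -/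
def rightAction : Cᵐᵒᵖ →ₐ[k] Module.End k (TensorOver k B M N) where
  toFun c := (balancedRel k B M N).mapQ (balancedRel k B M N)
    ((Algebra.lsmul k k N c).lTensor M) (by
      refine Submodule.span_le.2 ?_
      rintro _ ⟨b, m, n, rfl⟩
      refine Submodule.subset_span ⟨b, m, c • n, ?_⟩
      simp [smul_comm b c n])
  map_one' := by
    ext m n
    exact congrArg (Submodule.Quotient.mk (p := balancedRel k B M N))
      (show m ⊗ₜ[k] ((1 : Cᵐᵒᵖ) • n) = m ⊗ₜ[k] n by rw [one_smul])
  map_mul' a b := by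
    ext m n
    exact congrArg (Submodule.Quotient.mk (p := balancedRel k B M N))
      (show m ⊗ₜ[k] ((a * b) • n) = m ⊗ₜ[k] (a • b • n) by rw [mul_smul])
  map_zero' := by
    ext m n
    exact congrArg (Submodule.Quotient.mk (p := balancedRel k B M N))
      (show m ⊗ₜ[k] ((0 : Cᵐᵒᵖ) • n) = (0 : M ⊗[k] N) by
        rw [zero_smul, TensorProduct.tmul_zero])
  map_add' a b := by
    ext m n
    exact congrArg (Submodule.Quotient.mk (p := balancedRel k B M N))
      (show m ⊗ₜ[k] ((a + b) • n) = m ⊗ₜ[k] (a • n) + m ⊗ₜ[k] (b • n) by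
        rw [add_smul, TensorProduct.tmul_add])
  commutes' c := by
    ext m n
    exact congrArg (Submodule.Quotient.mk (p := balancedRel k B M N))
      (show m ⊗ₜ[k] (algebraMap k Cᵐᵒᵖ c • n) = c • m ⊗ₜ[k] n by
        rw [algebraMap_smul, TensorProduct.tmul_smul])

/-- The action `(a ⊗ c) (m ⊗ n) = am ⊗ nc` of `A ⊗ Cᵐᵒᵖ` on `M ⊗_B N`. -/
def biAction : A ⊗[k] Cᵐᵒᵖ →ₐ[k] Module.End k (TensorOver k B M N) :=
  Algebra.TensorProduct.lift (leftAction k A B M N) (rightAction k B C M N)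
    fun _ _ => by ext m n; rfl

/-- The `A`-`C`-bimodule structure of `M ⊗_B N`, as a left `A ⊗ Cᵐᵒᵖ`-module structure. -/
@[reducible]
def tensorOverModule : Module (A ⊗[k] Cᵐᵒᵖ) (TensorOver k B M N) :=
  Module.compHom (TensorOver k B M N) (biAction k A B C M N).toRingHom

theorem tensorOverModule_smul (a : A) (c : C) (m : M) (n : N) :
    letI := tensorOverModule k A B C M N
    ((a ⊗ₜ[k] MulOpposite.op c) • (Submodule.Quotient.mk (m ⊗ₜ[k] n) : TensorOver k B M N)) =
      Submodule.Quotient.mk ((a • m) ⊗ₜ[k] (MulOpposite.op c • n)) := by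
  have h : biAction k A B C M N (a ⊗ₜ[k] MulOpposite.op c) =
      leftAction k A B M N a * rightAction k B C M N (MulOpposite.op c) :=
    Algebra.TensorProduct.lift_tmul _ _ _ _ _
  exact LinearMap.congr_fun h (Submodule.Quotient.mk (m ⊗ₜ[k] n))

end Tensor

/-! ### Singular equivalences of Morita type with level -/

section Level

variable (k : Type u) [Field k] (A B : Type u) [Ring A] [Algebra k A] [Ring B] [Algebra k B]

/-- The enveloping algebra `Aᵉ = A ⊗ Aᵒᵖ`. -/
abbrev Env : Type u := A ⊗[k] Aᵐᵒᵖ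

/-- `A` as a left `Aᵉ`-module: `(a ⊗ b) • x = a x b`. -/
def regularBimodule : ModuleCat.{u} (Env k A) :=
  letI : Module (Env k A) A := TensorProduct.Algebra.module
  ModuleCat.of (Env k A) A

/-- `M ⊗_B N` as an `A`-`A`-bimodule, i.e. as a left `Aᵉ`-module. -/
def tensorBimodule (M N : Type u)
    [AddCommGroup M] [Module k M] [Module A M] [Module Bᵐᵒᵖ M]
    [IsScalarTower k A M] [IsScalarTower k Bᵐᵒᵖ M] [SMulCommClass A Bᵐᵒᵖ M]
    [AddCommGroup N] [Module k N] [Module B N] [Module Aᵐᵒᵖ N]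
    [IsScalarTower k B N] [IsScalarTower k Aᵐᵒᵖ N] [SMulCommClass B Aᵐᵒᵖ N] :
    ModuleCat.{u} (Env k A) :=
  letI := tensorOverModule k A B A M N
  ModuleCat.of (Env k A) (TensorOver k B M N)

/-- The `A`-`B`-bimodule `M` and the `B`-`A`-bimodule `N` define a singular equivalence of Morita
type with level `n`. -/
structure IsSingularEquivalence (M N : Type u)
    [AddCommGroup M] [Module k M] [Module A M] [Module Bᵐᵒᵖ M]
    [IsScalarTower k A M] [IsScalarTower k Bᵐᵒᵖ M] [SMulCommClass A Bᵐᵒᵖ M]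
    [AddCommGroup N] [Module k N] [Module B N] [Module Aᵐᵒᵖ N]
    [IsScalarTower k B N] [IsScalarTower k Aᵐᵒᵖ N] [SMulCommClass B Aᵐᵒᵖ N]
    (n : ℕ) : Prop where
  finite_left_M : Module.Finite A M
  projective_left_M : Module.Projective A M
  finite_right_M : Module.Finite Bᵐᵒᵖ M
  projective_right_M : Module.Projective Bᵐᵒᵖ M
  finite_left_N : Module.Finite B N
  projective_left_N : Module.Projective B N
  finite_right_N : Module.Finite Aᵐᵒᵖ N
  projective_right_N : Module.Projective Aᵐᵒᵖ N
  /-- `M ⊗_B N ≅ Ωⁿ(A)` in the stable category of `Aᵉ`-modules. -/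
  tensor_MN : ∃ K : ModuleCat.{u} (Env k A), IsSyzygy (Env k A) n (regularBimodule k A) K ∧
    StablyIsomorphic (Env k A) (tensorBimodule k A B M N) K
  /-- `N ⊗_A M ≅ Ωⁿ(B)` in the stable category of `Bᵉ`-modules. -/
  tensor_NM : ∃ K : ModuleCat.{u} (Env k B), IsSyzygy (Env k B) n (regularBimodule k B) K ∧
    StablyIsomorphic (Env k B) (tensorBimodule k B A N M) K

/-- `A` and `B` are singularly equivalent of Morita type with level: some pair of bimodules
defines a singular equivalence of Morita type with level `n`, for some `n ≥ 0`. -/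
def SingularlyEquivalent : Prop :=
  ∃ (n : ℕ)
    (M : Type u) (_ : AddCommGroup M) (_ : Module k M) (_ : Module A M) (_ : Module Bᵐᵒᵖ M)
    (_ : IsScalarTower k A M) (_ : IsScalarTower k Bᵐᵒᵖ M) (_ : SMulCommClass A Bᵐᵒᵖ M)
    (N : Type u) (_ : AddCommGroup N) (_ : Module k N) (_ : Module B N) (_ : Module Aᵐᵒᵖ N)
    (_ : IsScalarTower k B N) (_ : IsScalarTower k Aᵐᵒᵖ N) (_ : SMulCommClass B Aᵐᵒᵖ N),
    IsSingularEquivalence k A B M N n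

end Level

end SingularMorita

/-
The functors `M ⊗_B -` and `N ⊗_A -` are exact and preserve finitely generated projective
modules, hence syzygies, and they are additive. Since a syzygy of the regular bimodule is
projective on the right, its exact sequence splits and stays exact under `- ⊗_B Y`; therefore
`N ⊗_A M ⊗_B Y` is stably isomorphic to the `n`-th syzygy of `Y`. By the Krull-Schmidt theorem a
class of modules is representation-finite if and only if it is contained in `add V` for a single
finitely generated module `V`. So if `V` witnesses either property for `A`, then
`(N ⊗_A V) ⊕ B` witnesses it for `B`, with the level raised by `n`.
-/

namespace SingularMorita

section StableCategory

variable {R : Type u} [Ring R]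
  {X Y Z W : Type u} [AddCommGroup X] [Module R X] [AddCommGroup Y] [Module R Y]
  [AddCommGroup Z] [Module R Z] [AddCommGroup W] [Module R W]

theorem factorsThroughProjective_comp {P : Type u} [AddCommGroup P] [Module R P]
    [Module.Finite R P] [Module.Projective R P] (h : P →ₗ[R] Y) (g : X →ₗ[R] P) :
    FactorsThroughProjective (h ∘ₗ g) :=
  ⟨ModuleCat.of R P, g, h, ‹_›, ‹_›, rfl⟩

theorem factorsThroughProjective_zero : FactorsThroughProjective (0 : X →ₗ[R] Y) :=
  factorsThroughProjective_comp (P := PUnit) 0 0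

namespace FactorsThroughProjective

theorem comp_left {f : X →ₗ[R] Y} (hf : FactorsThroughProjective f) (a : Y →ₗ[R] Z) :
    FactorsThroughProjective (a ∘ₗ f) := by
  obtain ⟨P, g, h, _, _, rfl⟩ := hf
  exact factorsThroughProjective_comp (a ∘ₗ h) g

theorem comp_right {f : X →ₗ[R] Y} (hf : FactorsThroughProjective f) (a : W →ₗ[R] X) :
    FactorsThroughProjective (f ∘ₗ a) := by
  obtain ⟨P, g, h, _, _, rfl⟩ := hf
  exact factorsThroughProjective_comp h (g ∘ₗ a)

theorem add {f f' : X →ₗ[R] Y} (hf : FactorsThroughProjective f)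
    (hf' : FactorsThroughProjective f') : FactorsThroughProjective (f + f') := by
  obtain ⟨P, g, h, _, _, rfl⟩ := hf
  obtain ⟨P', g', h', _, _, rfl⟩ := hf'
  rw [← LinearMap.coprod_comp_prod h h' g g']
  exact factorsThroughProjective_comp _ _

theorem finite_and_projective (h : FactorsThroughProjective (LinearMap.id : X →ₗ[R] X)) :
    Module.Finite R X ∧ Module.Projective R X := by
  obtain ⟨P, i, r, _, _, hri⟩ := h
  exact ⟨.of_surjective r (LinearMap.surjective_of_comp_eq_id i r hri.symm),
    .of_split i r hri.symm⟩

end FactorsThroughProjective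

theorem StablyIsomorphic.of_equiv (e : X ≃ₗ[R] Y) : StablyIsomorphic R X Y :=
  ⟨e, e.symm, by simpa using factorsThroughProjective_zero,
    by simpa using factorsThroughProjective_zero⟩

theorem StablyIsomorphic.trans (h : StablyIsomorphic R X Y) (h' : StablyIsomorphic R Y Z) :
    StablyIsomorphic R X Z := by
  obtain ⟨f, g, hgf, hfg⟩ := h
  obtain ⟨f', g', hgf', hfg'⟩ := h'
  refine ⟨f' ∘ₗ f, g ∘ₗ g', ?_, ?_⟩
  · convert ((hgf'.comp_left g).comp_right f).add hgf using 1
    ext x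
    simp
  · convert ((hfg.comp_left f').comp_right g').add hfg' using 1
    ext x
    simp

theorem exists_comp_eq_of_comp_eq_zero {f : X →ₗ[R] Y} {g : Y →ₗ[R] Z}
    (hf : Function.Injective f) (hfg : Function.Exact f g) {w : W →ₗ[R] Y} (hw : g ∘ₗ w = 0) :
    ∃ d : W →ₗ[R] X, f ∘ₗ d = w := by
  have hrange (x : W) : w x ∈ LinearMap.range f := (hfg _).1 (LinearMap.congr_fun hw x)
  refine ⟨(LinearEquiv.ofInjective f hf).symm ∘ₗ w.codRestrict _ hrange, ?_⟩
  ext x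
  exact congrArg Subtype.val ((LinearEquiv.ofInjective f hf).apply_symm_apply ⟨w x, hrange x⟩)

section Ladder

variable {K P Y' L P' : Type u} [AddCommGroup K] [Module R K] [AddCommGroup P] [Module R P]
  [AddCommGroup Y'] [Module R Y'] [AddCommGroup L] [Module R L] [AddCommGroup P'] [Module R P']
  {f : K →ₗ[R] P} {g : P →ₗ[R] Y} {f' : L →ₗ[R] P'} {g' : P' →ₗ[R] Y'}

theorem exists_ladder [Module.Projective R P] (hfg : g ∘ₗ f = 0) (hf' : Function.Injective f')
    (hfg' : Function.Exact f' g') (hg' : Function.Surjective g') (c : Y →ₗ[R] Y') :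
    ∃ (a : K →ₗ[R] L) (b : P →ₗ[R] P'), f' ∘ₗ a = b ∘ₗ f ∧ g' ∘ₗ b = c ∘ₗ g := by
  obtain ⟨b, hb⟩ := Module.projective_lifting_property g' (c ∘ₗ g) hg'
  obtain ⟨a, ha⟩ := exists_comp_eq_of_comp_eq_zero hf' hfg' (w := b ∘ₗ f)
    (by rw [← LinearMap.comp_assoc, hb, LinearMap.comp_assoc, hfg, LinearMap.comp_zero])
  exact ⟨a, b, ha, hb⟩

theorem FactorsThroughProjective.of_ladder [Module.Finite R P] [Module.Projective R P]
    (hfg : g ∘ₗ f = 0) (hf' : Function.Injective f') (hfg' : Function.Exact f' g')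
    (hg' : Function.Surjective g') {a : K →ₗ[R] L} {b : P →ₗ[R] P'} {c : Y →ₗ[R] Y'}
    (hab : f' ∘ₗ a = b ∘ₗ f) (hbc : g' ∘ₗ b = c ∘ₗ g) (hc : FactorsThroughProjective c) :
    FactorsThroughProjective a := by
  obtain ⟨Q, q, h, _, _, rfl⟩ := hc
  obtain ⟨l, rfl⟩ := Module.projective_lifting_property g' h hg'
  -- `b` and `l ∘ q ∘ g` both cover `c`, so they differ by a map into `L`,
  -- through which `a` factors.
  obtain ⟨d, hd⟩ := exists_comp_eq_of_comp_eq_zero hf' hfg' (w := b - l ∘ₗ q ∘ₗ g)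
    (by rw [LinearMap.comp_sub, hbc]; simp only [LinearMap.comp_assoc, sub_self])
  have ha : a = d ∘ₗ f := by
    refine (LinearMap.cancel_left hf').1 ?_
    rw [← LinearMap.comp_assoc, hd, LinearMap.sub_comp, hab, LinearMap.comp_assoc,
      LinearMap.comp_assoc, hfg, LinearMap.comp_zero, LinearMap.comp_zero, sub_zero]
  exact ha ▸ factorsThroughProjective_comp d f

theorem FactorsThroughProjective.comp_sub_id_of_ladder [Module.Finite R P] [Module.Projective R P]
    (hf : Function.Injective f) (hfg : Function.Exact f g) (hg : Function.Surjective g)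
    {a : K →ₗ[R] L} {b : P →ₗ[R] P'} {c : Y →ₗ[R] Y'}
    (hab : f' ∘ₗ a = b ∘ₗ f) (hbc : g' ∘ₗ b = c ∘ₗ g)
    {a' : L →ₗ[R] K} {b' : P' →ₗ[R] P} {c' : Y' →ₗ[R] Y}
    (hab' : f ∘ₗ a' = b' ∘ₗ f') (hbc' : g ∘ₗ b' = c' ∘ₗ g')
    (hc : FactorsThroughProjective (c' ∘ₗ c - LinearMap.id)) :
    FactorsThroughProjective (a' ∘ₗ a - LinearMap.id) := by
  refine .of_ladder (b := b' ∘ₗ b - LinearMap.id) hfg.linearMap_comp_eq_zero hf hfg hg ?_ ?_ hc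
  · rw [LinearMap.comp_sub, LinearMap.sub_comp, ← LinearMap.comp_assoc, hab', LinearMap.comp_assoc,
      hab, LinearMap.comp_assoc, LinearMap.comp_id, LinearMap.id_comp]
  · rw [LinearMap.comp_sub, LinearMap.sub_comp, ← LinearMap.comp_assoc, hbc', LinearMap.comp_assoc,
      hbc, LinearMap.comp_assoc, LinearMap.comp_id, LinearMap.id_comp]

theorem StablyIsomorphic.kernel [Module.Finite R P] [Module.Projective R P]
    [Module.Finite R P'] [Module.Projective R P']
    (hf : Function.Injective f) (hfg : Function.Exact f g) (hg : Function.Surjective g)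
    (hf' : Function.Injective f') (hfg' : Function.Exact f' g') (hg' : Function.Surjective g')
    (h : StablyIsomorphic R Y Y') : StablyIsomorphic R K L := by
  obtain ⟨c, c', hc, hc'⟩ := h
  obtain ⟨a, b, hab, hbc⟩ := exists_ladder hfg.linearMap_comp_eq_zero hf' hfg' hg' c
  obtain ⟨a', b', hab', hbc'⟩ := exists_ladder hfg'.linearMap_comp_eq_zero hf hfg hg c'
  exact ⟨a, a', .comp_sub_id_of_ladder hf hfg hg hab hbc hab' hbc' hc,
    .comp_sub_id_of_ladder hf' hfg' hg' hab' hbc' hab hbc hc'⟩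

end Ladder

theorem nonempty_equiv_prod_ker {i : X →ₗ[R] Y} {r : Y →ₗ[R] X} (hri : r ∘ₗ i = LinearMap.id) :
    Nonempty (Y ≃ₗ[R] LinearMap.ker r × X) :=
  ⟨(r.exact_subtype_ker_map.splitSurjectiveEquiv (Submodule.injective_subtype _) ⟨i, hri⟩).1⟩

theorem finite_and_projective_ker {i : X →ₗ[R] Y} {r : Y →ₗ[R] X} (hri : r ∘ₗ i = LinearMap.id)
    (hir : FactorsThroughProjective (i ∘ₗ r - LinearMap.id)) :
    Module.Finite R (LinearMap.ker r) ∧ Module.Projective R (LinearMap.ker r) := by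
  let π : Y →ₗ[R] LinearMap.ker r := (LinearMap.id - i ∘ₗ r).codRestrict _ fun y => by
    simp [← LinearMap.comp_apply r i, hri]
  refine FactorsThroughProjective.finite_and_projective ?_
  convert (hir.comp_right (LinearMap.ker r).subtype).comp_left (-π) using 1
  ext ⟨x, hx⟩
  simp [π, LinearMap.mem_ker.1 hx]

namespace FactorsThroughProjective

variable {P : Type u} [AddCommGroup P] [Module R P] [Module.Finite R P] [Module.Projective R P]

theorem of_comp_inl {f : X × P →ₗ[R] Y} (hf : FactorsThroughProjective (f ∘ₗ LinearMap.inl R X P)) :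
    FactorsThroughProjective f := by
  convert (hf.comp_right (LinearMap.fst R X P)).add
    (factorsThroughProjective_comp (f ∘ₗ LinearMap.inr R X P) (LinearMap.snd R X P)) using 1
  ext <;> simp [Prod.mk_zero_zero]

theorem of_fst_comp {f : X →ₗ[R] Y × P} (hf : FactorsThroughProjective (LinearMap.fst R Y P ∘ₗ f)) :
    FactorsThroughProjective f := by
  convert (hf.comp_left (LinearMap.inl R Y P)).add
    (factorsThroughProjective_comp (LinearMap.inr R Y P) (LinearMap.snd R Y P ∘ₗ f)) using 1
  ext <;> simp

end FactorsThroughProjective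

theorem StablyIsomorphic.exists_prod_equiv_prod (h : StablyIsomorphic R X Y) :
    ∃ P Q : ModuleCat.{u} R, (Module.Finite R P ∧ Module.Projective R P) ∧
      (Module.Finite R Q ∧ Module.Projective R Q) ∧ Nonempty ((Y × P) ≃ₗ[R] Q × X) := by
  obtain ⟨f, g, ⟨P, q, p, _, _, hgf⟩, hfg⟩ := h
  let i : X →ₗ[R] Y × P := f.prod q
  let r : Y × P →ₗ[R] X := g.coprod (-p)
  have hri : r ∘ₗ i = LinearMap.id := by
    rw [LinearMap.coprod_comp_prod, LinearMap.neg_comp, ← hgf]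
    abel
  have hir : FactorsThroughProjective (i ∘ₗ r - LinearMap.id) := by
    refine .of_comp_inl (.of_fst_comp ?_)
    convert hfg using 1
    ext y
    simp [i, r]
  exact ⟨P, ModuleCat.of R (LinearMap.ker r), ⟨‹_›, ‹_›⟩, finite_and_projective_ker hri hir,
    nonempty_equiv_prod_ker hri⟩

end StableCategory

section Syzygy

variable {R : Type u} [Ring R] {X X' K K' : ModuleCat.{u} R} {m n : ℕ}

theorem IsSyzygy.stablyIsomorphic (hX : StablyIsomorphic R X X') (h : IsSyzygy R n X K)
    (h' : IsSyzygy R n X' K') : StablyIsomorphic R K K' := by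
  induction n generalizing K K' with
  | zero => exact ((StablyIsomorphic.of_equiv h.some).trans hX).trans (.of_equiv h'.some.symm)
  | succ n ih =>
    obtain ⟨Y, P, f, g, hY, _, _, hf, hfg, hg⟩ := h
    obtain ⟨Y', P', f', g', hY', _, _, hf', hfg', hg'⟩ := h'
    exact .kernel hf hfg hg hf' hfg' hg' (ih hY hY')

theorem IsSyzygy.exists_of_add (h : IsSyzygy R (m + n) X K) :
    ∃ Y, IsSyzygy R m X Y ∧ IsSyzygy R n Y K := by
  induction n generalizing K with
  | zero => exact ⟨K, h, ⟨LinearEquiv.refl R K⟩⟩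
  | succ n ih =>
    obtain ⟨Y, P, f, g, hY, hP⟩ := h
    obtain ⟨Z, hZ, hZY⟩ := ih hY
    exact ⟨Z, hZ, Y, P, f, g, hZY, hP⟩

theorem IsSyzygy.finite [IsNoetherianRing R] [Module.Finite R X] (h : IsSyzygy R n X K) :
    Module.Finite R K := by
  cases n with
  | zero => exact .equiv h.some.symm
  | succ n =>
    obtain ⟨Y, P, f, g, -, _, _, hf, -⟩ := h
    exact .of_injective f hf

end Syzygy

section DirectSummands

variable {R : Type u} [Ring R] {V W X Y Z : Type u} [AddCommGroup V] [Module R V]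
  [AddCommGroup W] [Module R W] [AddCommGroup X] [Module R X] [AddCommGroup Y] [Module R Y]
  [AddCommGroup Z] [Module R Z]

namespace IsDirectSummand

theorem refl (X : Type u) [AddCommGroup X] [Module R X] : IsDirectSummand R X X :=
  ⟨LinearMap.id, LinearMap.id, rfl⟩

theorem trans (h : IsDirectSummand R X Y) (h' : IsDirectSummand R Y Z) :
    IsDirectSummand R X Z := by
  obtain ⟨i, r, hri⟩ := h
  obtain ⟨j, s, hsj⟩ := h'
  refine ⟨j ∘ₗ i, r ∘ₗ s, ?_⟩
  rw [LinearMap.comp_assoc, ← LinearMap.comp_assoc i, hsj, LinearMap.id_comp, hri]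

theorem of_equiv (e : X ≃ₗ[R] Y) : IsDirectSummand R X Y :=
  ⟨e, e.symm, e.symm_comp⟩

theorem prod_left : IsDirectSummand R X (X × Y) :=
  ⟨LinearMap.inl R X Y, LinearMap.fst R X Y, LinearMap.fst_comp_inl R X Y⟩

theorem prod_right : IsDirectSummand R Y (X × Y) :=
  ⟨LinearMap.inr R X Y, LinearMap.snd R X Y, LinearMap.snd_comp_inr R X Y⟩

theorem exists_injective (h : IsDirectSummand R X Y) :
    ∃ f : X →ₗ[R] Y, Function.Injective f :=
  let ⟨i, r, hri⟩ := h
  ⟨i, LinearMap.injective_of_comp_eq_id i r hri⟩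

theorem nonempty_equiv [Nontrivial X] (h : IsDirectSummand R X Y) (hY : IsIndecomposable R Y) :
    Nonempty (X ≃ₗ[R] Y) := by
  obtain ⟨i, r, hri⟩ := h
  have hi := LinearMap.injective_of_comp_eq_id i r hri
  have hr := LinearMap.range_eq_top.2 (LinearMap.surjective_of_comp_eq_id i r hri)
  have hir : IsIdempotentElem (i ∘ₗ r : Module.End R Y) := by
    rw [IsIdempotentElem, Module.End.mul_eq_comp, LinearMap.comp_assoc, ← LinearMap.comp_assoc r,
      hri, LinearMap.id_comp]
  have hcompl := LinearMap.IsIdempotentElem.isCompl hir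
  rw [LinearMap.range_comp_of_range_eq_top i hr,
    LinearMap.ker_comp_of_ker_eq_bot r (LinearMap.ker_eq_bot.2 hi)] at hcompl
  obtain hbot | hbot := hY.2 _ _ hcompl
  · obtain ⟨x, hx⟩ := exists_ne (0 : X)
    exact absurd (hi (by rw [LinearMap.range_eq_bot.1 hbot]; rfl)) hx
  · exact ⟨.ofBijective i ⟨hi, LinearMap.range_eq_top.1 (eq_top_of_isCompl_bot (hbot ▸ hcompl))⟩⟩

end IsDirectSummand

namespace IsInAdd

theorem of_isDirectSummand (h : IsInAdd R Y V) (hX : IsDirectSummand R X Y) : IsInAdd R X V :=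
  let ⟨n, hn⟩ := h
  ⟨n, hX.trans hn⟩

theorem self : IsInAdd R V V :=
  ⟨1, .of_equiv (LinearEquiv.funUnique (Fin 1) R V).symm⟩

theorem mono (h : IsInAdd R X V) (hV : IsDirectSummand R V W) : IsInAdd R X W := by
  obtain ⟨n, hn⟩ := h
  obtain ⟨i, r, hri⟩ := hV
  refine ⟨n, hn.trans ⟨i.compLeft (Fin n), r.compLeft (Fin n), ?_⟩⟩
  exact LinearMap.ext fun x => funext fun j => LinearMap.congr_fun hri (x j)

theorem trans (h : IsInAdd R X V) (h' : IsInAdd R V W) : IsInAdd R X W := by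
  obtain ⟨m, hm⟩ := h'
  obtain ⟨n, hn⟩ := h.mono hm
  exact ⟨n * m, hn.trans (.of_equiv ((LinearEquiv.curry R W (Fin n) (Fin m)).symm ≪≫ₗ
    LinearEquiv.funCongrLeft R W finProdFinEquiv.symm))⟩

theorem prod (h : IsInAdd R X V) (h' : IsInAdd R Y V) : IsInAdd R (X × Y) V := by
  obtain ⟨m, i, r, hri⟩ := h
  obtain ⟨n, j, s, hsj⟩ := h'
  refine ⟨m + n, .trans ⟨i.prodMap j, r.prodMap s, ?_⟩
    (.of_equiv ((LinearEquiv.sumArrowLequivProdArrow (Fin m) (Fin n) R V).symm ≪≫ₗ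
      LinearEquiv.funCongrLeft R V finSumFinEquiv.symm))⟩
  rw [LinearMap.prodMap_comp, hri, hsj, LinearMap.prodMap_id]

theorem of_projective [Module.Finite R X] [Module.Projective R X] : IsInAdd R X R :=
  let ⟨n, r, i, _, _, hri⟩ := Module.Finite.exists_comp_eq_id_of_projective R X
  ⟨n, i, r, hri⟩

theorem finite [Module.Finite R V] (h : IsInAdd R X V) : Module.Finite R X :=
  let ⟨_, i, r, hri⟩ := h
  .of_surjective r (LinearMap.surjective_of_comp_eq_id i r hri)

theorem projective (h : IsInAdd R X R) : Module.Projective R X :=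
  let ⟨_, i, r, hri⟩ := h
  .of_split i r hri

theorem of_sum_comp_eq_id {n : ℕ} (a : Fin n → X →ₗ[R] V) (b : Fin n → V →ₗ[R] X)
    (hab : ∑ i, b i ∘ₗ a i = LinearMap.id) : IsInAdd R X V := by
  refine ⟨n, LinearMap.pi a, LinearMap.lsum R (fun _ => V) ℕ b, ?_⟩
  rw [← hab]
  ext x
  simp [LinearMap.lsum_apply]

theorem exists_sum_comp_eq_id (h : IsInAdd R X V) :
    ∃ (n : ℕ) (a : Fin n → X →ₗ[R] V) (b : Fin n → V →ₗ[R] X),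
      ∑ i, b i ∘ₗ a i = LinearMap.id := by
  obtain ⟨n, i, r, hri⟩ := h
  refine ⟨n, fun j => LinearMap.proj j ∘ₗ i, fun j => r ∘ₗ LinearMap.single R (fun _ => V) j, ?_⟩
  rw [← hri]
  ext x
  simp [← map_sum, Finset.univ_sum_single]

theorem of_stablyIsomorphic (h : StablyIsomorphic R X Y) (hX : IsInAdd R X V) :
    IsInAdd R Y (V × R) := by
  obtain ⟨P, Q, -, ⟨_, _⟩, ⟨e⟩⟩ := h.exists_prod_equiv_prod
  have hQX : IsInAdd R (Q × X) (V × R) :=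
    (of_projective.mono .prod_right).prod (hX.mono .prod_left)
  exact hQX.of_isDirectSummand (IsDirectSummand.prod_left.trans (.of_equiv e))

end IsInAdd

end DirectSummands

section KrullSchmidt

variable {R : Type u} [Ring R] {V X Y Z : Type u} [AddCommGroup V] [Module R V]
  [AddCommGroup X] [Module R X] [AddCommGroup Y] [Module R Y] [AddCommGroup Z] [Module R Z]

theorem IsIndecomposable.isLocalRing_end [IsArtinian R X] [IsNoetherian R X]
    (h : IsIndecomposable R X) : IsLocalRing (Module.End R X) := by
  have : Nontrivial X := h.1
  refine IsLocalRing.of_isUnit_or_isUnit_one_sub_self fun f => ?_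
  -- Fitting: `X` is the direct sum of the kernel and the range of a high power of `f`.
  obtain ⟨n, hn⟩ := Filter.eventually_atTop.1 (LinearMap.eventually_isCompl_ker_pow_range_pow f)
  have hcompl := hn (n + 1) n.le_succ
  obtain hker | hrange := h.2 _ _ hcompl
  · refine .inl ((isUnit_pow_iff n.succ_ne_zero).1 ((Module.End.isUnit_iff _).2 ⟨?_, ?_⟩))
    · exact LinearMap.ker_eq_bot.1 hker
    · exact LinearMap.range_eq_top.1 (eq_top_of_bot_isCompl (hker ▸ hcompl))
  · exact .inr (IsNilpotent.isUnit_one_sub ⟨n + 1, LinearMap.range_eq_bot.1 hrange⟩)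

theorem isDirectSummand_of_isUnit {a : Z →ₗ[R] X} {b : X →ₗ[R] Z}
    (h : IsUnit (b ∘ₗ a : Module.End R Z)) : IsDirectSummand R Z X :=
  let ⟨c, hc⟩ := h.exists_left_inv
  ⟨a, c ∘ₗ b, hc⟩

theorem IsDirectSummand.of_prod [IsLocalRing (Module.End R Z)] (h : IsDirectSummand R Z (X × Y)) :
    IsDirectSummand R Z X ∨ IsDirectSummand R Z Y := by
  obtain ⟨i, r, hri⟩ := h
  have hsum : ((r ∘ₗ LinearMap.inl R X Y) ∘ₗ (LinearMap.fst R X Y ∘ₗ i) : Module.End R Z) +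
      (r ∘ₗ LinearMap.inr R X Y) ∘ₗ (LinearMap.snd R X Y ∘ₗ i) = 1 := by
    rw [Module.End.one_eq_id, ← hri]
    ext z
    simp [← map_add]
  exact (IsLocalRing.isUnit_or_isUnit_of_isUnit_add (hsum ▸ isUnit_one)).imp
    isDirectSummand_of_isUnit isDirectSummand_of_isUnit

theorem IsInAdd.isDirectSummand [IsLocalRing (Module.End R Z)] (h : IsInAdd R Z V) :
    IsDirectSummand R Z V := by
  obtain ⟨n, a, b, hab⟩ := h.exists_sum_comp_eq_id
  obtain ⟨i, -, hi⟩ := IsLocalRing.exists_of_isUnit_sum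
    (show IsUnit (∑ i, b i ∘ₗ a i : Module.End R Z) from hab ▸ isUnit_one)
  exact isDirectSummand_of_isUnit hi

@[elab_as_elim]
theorem isFiniteLength_induction {motive : ModuleCat.{u} R → Prop}
    (subsingleton : ∀ X : ModuleCat.{u} R, Subsingleton X → motive X)
    (indecomposable : ∀ X : ModuleCat.{u} R, IsFiniteLength R X → IsIndecomposable R X → motive X)
    (prod : ∀ X Y Z : ModuleCat.{u} R, ((Y × Z) ≃ₗ[R] X) → motive Y → motive Z → motive X)
    (X : ModuleCat.{u} R) (hX : IsFiniteLength R X) : motive X := by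
  obtain ⟨_, _⟩ := isFiniteLength_iff_isNoetherian_isArtinian.1 hX
  obtain h₀ | _ := subsingleton_or_nontrivial X
  · exact subsingleton X h₀
  by_cases h₁ : IsIndecomposable R X
  · exact indecomposable X hX h₁
  obtain ⟨p, q, hpq, hp, hq⟩ : ∃ p q : Submodule R X, IsCompl p q ∧ p ≠ ⊥ ∧ q ≠ ⊥ := by
    simpa [IsIndecomposable, ‹Nontrivial X›] using h₁
  have : Module.length R p < Module.length R X :=
    Submodule.length_lt fun h => hq (eq_bot_of_top_isCompl (h ▸ hpq))
  have : Module.length R q < Module.length R X :=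
    Submodule.length_lt fun h => hp (eq_bot_of_isCompl_top (h ▸ hpq))
  exact prod X (ModuleCat.of R p) (ModuleCat.of R q) (Submodule.prodEquivOfIsCompl p q hpq)
    (isFiniteLength_induction subsingleton indecomposable prod (ModuleCat.of R p)
      (hX.of_injective p.subtype_injective))
    (isFiniteLength_induction subsingleton indecomposable prod (ModuleCat.of R q)
      (hX.of_injective q.subtype_injective))
termination_by Module.length R X

theorem isInAdd_of_forall_indecomposable (X : ModuleCat.{u} R) (hX : IsFiniteLength R X)
    (h : ∀ Z : ModuleCat.{u} R, IsFiniteLength R Z → IsIndecomposable R Z →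
      IsDirectSummand R Z X → IsInAdd R Z V) : IsInAdd R X V := by
  revert h
  refine isFiniteLength_induction ?_ ?_ ?_ X hX
  · exact fun X _ _ => ⟨0, 0, 0, Subsingleton.elim _ _⟩
  · exact fun X hX hX' h => h X hX hX' (.refl X)
  · exact fun X Y Z e ihY ihZ h => .of_isDirectSummand
      ((ihY fun W hW hW' hWY => h W hW hW' (hWY.trans (.trans .prod_left (.of_equiv e)))).prod
        (ihZ fun W hW hW' hWZ => h W hW hW' (hWZ.trans (.trans .prod_right (.of_equiv e)))))
      (.of_equiv e.symm)

theorem exists_list_indecomposable_summands (X : ModuleCat.{u} R) (hX : IsFiniteLength R X) :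
    ∃ L : List (ModuleCat.{u} R), ∀ Z : ModuleCat.{u} R, IsFiniteLength R Z →
      IsIndecomposable R Z → IsDirectSummand R Z X → ∃ Y ∈ L, Nonempty (Z ≃ₗ[R] Y) := by
  refine isFiniteLength_induction ?_ ?_ ?_ X hX
  · rintro X hX
    refine ⟨[], fun Z _ hZ hZX => ?_⟩
    obtain ⟨f, hf⟩ := hZX.exists_injective
    exact absurd hf.subsingleton (not_subsingleton_iff_nontrivial.2 hZ.1)
  · rintro X - hX
    refine ⟨[X], fun Z _ hZ hZX => ⟨X, List.mem_singleton_self X, ?_⟩⟩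
    have := hZ.1
    exact hZX.nonempty_equiv hX
  · rintro X Y Z e ⟨L, hL⟩ ⟨L', hL'⟩
    refine ⟨L ++ L', fun W hW hW' hWX => ?_⟩
    obtain ⟨_, _⟩ := isFiniteLength_iff_isNoetherian_isArtinian.1 hW
    have := hW'.isLocalRing_end
    obtain hWY | hWZ := (hWX.trans (.of_equiv e.symm)).of_prod
    · exact (hL W hW hW' hWY).imp fun U hU => ⟨List.mem_append_left L' hU.1, hU.2⟩
    · exact (hL' W hW hW' hWZ).imp fun U hU => ⟨List.mem_append_right L hU.1, hU.2⟩

variable [IsArtinianRing R]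

theorem isFiniteLength_of_finite [Module.Finite R X] : IsFiniteLength R X :=
  isFiniteLength_iff_isNoetherian_isArtinian.2 ⟨inferInstance, inferInstance⟩

theorem isRepresentationFinite_of_isInAdd {C : ModuleCat.{u} R → Prop} (V : ModuleCat.{u} R)
    [Module.Finite R V] (hV : ∀ K : ModuleCat.{u} R, C K → IsInAdd R K V) :
    IsRepresentationFinite R C := by
  obtain ⟨L, hL⟩ := exists_list_indecomposable_summands V isFiniteLength_of_finite
  refine ⟨L.length, L.get, fun Z _ hZ ⟨K, hK, hZK⟩ => ?_⟩
  have := hZ.isLocalRing_end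
  have hZV := ((hV K hK).of_isDirectSummand hZK).isDirectSummand
  obtain ⟨Y, hY, e⟩ := hL Z isFiniteLength_of_finite hZ hZV
  obtain ⟨i, rfl⟩ := List.get_of_mem hY
  exact ⟨i, e⟩

theorem IsRepresentationFinite.exists_isInAdd {C : ModuleCat.{u} R → Prop}
    (h : IsRepresentationFinite R C) :
    ∃ V : ModuleCat.{u} R, Module.Finite R V ∧
      ∀ K : ModuleCat.{u} R, Module.Finite R K → C K → IsInAdd R K V := by
  classical
  obtain ⟨r, L, hL⟩ := h
  let V := ∀ i : {i // Module.Finite R (L i)}, L i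
  have (i : {i // Module.Finite R (L i)}) : Module.Finite R (L i) := i.2
  refine ⟨ModuleCat.of R V, inferInstanceAs (Module.Finite R V), fun K _ hK =>
    isInAdd_of_forall_indecomposable K isFiniteLength_of_finite fun Z hZ hZ' hZK => ?_⟩
  have := (isFiniteLength_iff_isNoetherian_isArtinian.1 hZ).1
  obtain ⟨i, ⟨e⟩⟩ := hL Z inferInstance hZ' ⟨K, hK, hZK⟩
  let j : {i // Module.Finite R (L i)} := ⟨i, .equiv e⟩
  have hLV : IsDirectSummand R (L i) V :=
    ⟨LinearMap.single R (fun i : {i // Module.Finite R (L i)} => L i) j, LinearMap.proj j,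
      LinearMap.proj_comp_single_same ..⟩
  exact IsInAdd.self.of_isDirectSummand ((IsDirectSummand.of_equiv e).trans hLV)

end KrullSchmidt

section AddResolution

variable {R : Type u} [Ring R] {V W K K' P Q X Y : ModuleCat.{u} R}

/-- `K` is the cokernel of an injective map between modules in `add V`, as required of the syzygies
in the definition of an Igusa-Todorov algebra. -/
def HasShortAddResolution (V K : ModuleCat.{u} R) : Prop :=
  ∃ (V₁ V₀ : ModuleCat.{u} R) (f : V₁ →ₗ[R] V₀) (g : V₀ →ₗ[R] K),
    IsInAdd R V₁ V ∧ IsInAdd R V₀ V ∧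
    Function.Injective f ∧ Function.Exact f g ∧ Function.Surjective g

namespace HasShortAddResolution

theorem mono (h : HasShortAddResolution V K) (hV : IsDirectSummand R V W) :
    HasShortAddResolution W K :=
  let ⟨V₁, V₀, f, g, h₁, h₀, hfg⟩ := h
  ⟨V₁, V₀, f, g, h₁.mono hV, h₀.mono hV, hfg⟩

theorem of_equiv (h : HasShortAddResolution V K) (e : K ≃ₗ[R] K') :
    HasShortAddResolution V K' := by
  obtain ⟨V₁, V₀, f, g, h₁, h₀, hf, hfg, hg⟩ := h
  exact ⟨V₁, V₀, f, e ∘ₗ g, h₁, h₀, hf, hfg.comp_injective _ e.injective (map_zero e),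
    e.surjective.comp hg⟩

theorem prod (h : HasShortAddResolution V K) (hQ : IsInAdd R Q V) :
    HasShortAddResolution V (ModuleCat.of R (Q × K)) := by
  obtain ⟨V₁, V₀, f, g, h₁, h₀, hf, hfg, hg⟩ := h
  refine ⟨V₁, ModuleCat.of R (Q × V₀), LinearMap.inr R Q V₀ ∘ₗ f, LinearMap.id.prodMap g, h₁,
    hQ.prod h₀, LinearMap.inr_injective.comp hf, ?_, Function.surjective_id.prodMap hg⟩
  rintro ⟨q, v⟩
  simp [hfg v, eq_comm (a := q)]

theorem of_prod [Module.Projective R P]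
    (h : HasShortAddResolution V (ModuleCat.of R (K × P))) : HasShortAddResolution V K := by
  obtain ⟨V₁, V₀, f, g, h₁, h₀, hf, hfg, hg⟩ := h
  let r : V₀ →ₗ[R] P := LinearMap.snd R K P ∘ₗ g
  obtain ⟨s, hs⟩ := Module.projective_lifting_property r LinearMap.id (Prod.snd_surjective.comp hg)
  obtain ⟨e⟩ := nonempty_equiv_prod_ker hs
  have hrf (v : V₁) : f v ∈ LinearMap.ker r := by
    simp [r, hfg.apply_apply_eq_zero v]
  refine ⟨V₁, ModuleCat.of R (LinearMap.ker r), f.codRestrict _ hrf,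
    LinearMap.fst R K P ∘ₗ g ∘ₗ (LinearMap.ker r).subtype, h₁,
    h₀.of_isDirectSummand (IsDirectSummand.prod_left.trans (.of_equiv e.symm)),
    fun v w hvw => hf (congrArg Subtype.val hvw), ?_, fun x => ?_⟩
  · rintro ⟨v, hv⟩
    have hgv : g v = 0 ↔ (g v).1 = 0 := ⟨fun h => by rw [h]; rfl, fun h => Prod.ext h hv⟩
    simpa [Subtype.ext_iff, hgv] using hfg v
  · obtain ⟨v, hv⟩ := hg (x, 0)
    exact ⟨⟨v, congrArg Prod.snd hv⟩, congrArg Prod.fst hv⟩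

theorem of_stablyIsomorphic (h : HasShortAddResolution V X) (hXY : StablyIsomorphic R X Y) :
    HasShortAddResolution (ModuleCat.of R (V × R)) Y := by
  obtain ⟨P, Q, ⟨_, _⟩, ⟨_, _⟩, ⟨e⟩⟩ := hXY.exists_prod_equiv_prod
  have hQ : IsInAdd R Q (V × R) := IsInAdd.of_projective.mono .prod_right
  exact (((h.mono .prod_left).prod hQ).of_equiv (K' := ModuleCat.of R (Y × P)) e.symm).of_prod

end HasShortAddResolution

end AddResolution

open CategoryTheory

section Functors

variable {A B : Type u} [Ring A] [Ring B] (F : ModuleCat.{u} B ⥤ ModuleCat.{u} A)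
  {X Y Z : ModuleCat.{u} B}

/-- The action of an additive functor between module categories on linear maps. -/
def mapLinear [F.Additive] : (X →ₗ[B] Y) →+ (F.obj X →ₗ[A] F.obj Y) where
  toFun f := (F.map (ModuleCat.ofHom f)).hom
  map_zero' := by rw [ModuleCat.ofHom_zero, F.map_zero, ModuleCat.hom_zero]
  map_add' f g := by rw [ModuleCat.ofHom_add, F.map_add, ModuleCat.hom_add]

theorem nonempty_equiv_map (e : X ≃ₗ[B] Y) : Nonempty (F.obj X ≃ₗ[A] F.obj Y) :=
  ⟨(F.mapIso e.toModuleIso).toLinearEquiv⟩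

variable [F.Additive]

@[simp]
theorem mapLinear_id : mapLinear F (LinearMap.id : X →ₗ[B] X) = LinearMap.id :=
  congrArg ModuleCat.Hom.hom (F.map_id X)

theorem mapLinear_comp (g : Y →ₗ[B] Z) (f : X →ₗ[B] Y) :
    mapLinear F (g ∘ₗ f) = mapLinear F g ∘ₗ mapLinear F f :=
  congrArg ModuleCat.Hom.hom (F.map_comp (ModuleCat.ofHom f) (ModuleCat.ofHom g))

theorem IsInAdd.map (h : IsInAdd B X Y) : IsInAdd A (F.obj X) (F.obj Y) := by
  obtain ⟨n, a, b, hab⟩ := h.exists_sum_comp_eq_id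
  refine .of_sum_comp_eq_id (fun i => mapLinear F (a i)) (fun i => mapLinear F (b i)) ?_
  simp only [← mapLinear_comp, ← map_sum, hab, mapLinear_id]

section FactorsThroughProjective

variable (hF : IsInAdd A (F.obj (ModuleCat.of B B)) A)

include hF

theorem finite_and_projective_map (P : ModuleCat.{u} B) [Module.Finite B P]
    [Module.Projective B P] : Module.Finite A (F.obj P) ∧ Module.Projective A (F.obj P) :=
  have h : IsInAdd A (F.obj P) A := (IsInAdd.of_projective.map (Y := ModuleCat.of B B) F).trans hF
  ⟨h.finite, h.projective⟩

theorem FactorsThroughProjective.map {f : X →ₗ[B] Y} (hf : FactorsThroughProjective f) :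
    FactorsThroughProjective (mapLinear F f) := by
  obtain ⟨P, g, h, _, _, rfl⟩ := hf
  obtain ⟨_, _⟩ := finite_and_projective_map F hF P
  exact mapLinear_comp F h g ▸ factorsThroughProjective_comp _ _

theorem StablyIsomorphic.map (h : StablyIsomorphic B X Y) :
    StablyIsomorphic A (F.obj X) (F.obj Y) := by
  obtain ⟨f, g, hgf, hfg⟩ := h
  refine ⟨mapLinear F f, mapLinear F g, ?_, ?_⟩
  · simpa only [map_sub, mapLinear_comp, mapLinear_id] using hgf.map F hF
  · simpa only [map_sub, mapLinear_comp, mapLinear_id] using hfg.map F hF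

end FactorsThroughProjective

section Exact

theorem mapLinear_surjective [F.PreservesEpimorphisms] {f : X →ₗ[B] Y}
    (hf : Function.Surjective f) : Function.Surjective (mapLinear F f) := by
  have := (ModuleCat.epi_iff_surjective (ModuleCat.ofHom f)).2 hf
  exact (ModuleCat.epi_iff_surjective (F.map (ModuleCat.ofHom f))).1 inferInstance

theorem finite_map [F.PreservesEpimorphisms] (hF : Module.Finite A (F.obj (ModuleCat.of B B)))
    (X : ModuleCat.{u} B) [Module.Finite B X] : Module.Finite A (F.obj X) := by
  obtain ⟨n, f, hf⟩ := Module.Finite.exists_fin' B X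
  have hFn : IsInAdd A (F.obj (ModuleCat.of B (Fin n → B))) (F.obj (ModuleCat.of B B)) :=
    IsInAdd.map F (X := ModuleCat.of B (Fin n → B)) ⟨n, .refl _⟩
  have := hFn.finite
  exact .of_surjective _ (mapLinear_surjective F (X := ModuleCat.of B (Fin n → B)) hf)

variable [F.PreservesHomology]

theorem mapLinear_injective {f : X →ₗ[B] Y} (hf : Function.Injective f) :
    Function.Injective (mapLinear F f) := by
  have := (ModuleCat.mono_iff_injective (ModuleCat.ofHom f)).2 hf
  exact (ModuleCat.mono_iff_injective (F.map (ModuleCat.ofHom f))).1 inferInstance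

theorem mapLinear_exact {f : X →ₗ[B] Y} {g : Y →ₗ[B] Z} (hfg : Function.Exact f g) :
    Function.Exact (mapLinear F f) (mapLinear F g) := by
  let S := ShortComplex.mk (ModuleCat.ofHom f) (ModuleCat.ofHom g)
    (ModuleCat.hom_ext hfg.linearMap_comp_eq_zero)
  have hS : S.Exact := (ShortComplex.ShortExact.moduleCat_exact_iff_function_exact S).2 hfg
  exact (ShortComplex.ShortExact.moduleCat_exact_iff_function_exact _).1 (hS.map F)

theorem IsSyzygy.map (hF : IsInAdd A (F.obj (ModuleCat.of B B)) A) {n : ℕ}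
    {X K : ModuleCat.{u} B} (h : IsSyzygy B n X K) : IsSyzygy A n (F.obj X) (F.obj K) := by
  induction n generalizing K with
  | zero => exact nonempty_equiv_map F h.some
  | succ n ih =>
    obtain ⟨Y, P, f, g, hY, _, _, hf, hfg, hg⟩ := h
    obtain ⟨hP, hP'⟩ := finite_and_projective_map F hF P
    exact ⟨F.obj Y, F.obj P, mapLinear F f, mapLinear F g, ih hY, hP, hP',
      mapLinear_injective F hf, mapLinear_exact F hfg, mapLinear_surjective F hg⟩

theorem HasShortAddResolution.map {V K : ModuleCat.{u} B} (h : HasShortAddResolution V K) :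
    HasShortAddResolution (F.obj V) (F.obj K) := by
  obtain ⟨V₁, V₀, f, g, h₁, h₀, hf, hfg, hg⟩ := h
  exact ⟨F.obj V₁, F.obj V₀, mapLinear F f, mapLinear F g, h₁.map F, h₀.map F,
    mapLinear_injective F hf, mapLinear_exact F hfg, mapLinear_surjective F hg⟩

end Exact

section Transfer

variable {F} {G : ModuleCat.{u} A ⥤ ModuleCat.{u} B} [F.PreservesHomology] [G.Additive]
  (hF : IsInAdd A (F.obj (ModuleCat.of B B)) A)
  (hG : Module.Finite B (G.obj (ModuleCat.of A A))) {n : ℕ}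
  (hGF : ∀ Y K : ModuleCat.{u} B, Module.Finite B Y → IsSyzygy B n Y K →
    StablyIsomorphic B (G.obj (F.obj Y)) K)

include hF hG hGF

theorem IsSyzygyFinite.transfer [IsArtinianRing A] [IsArtinianRing B] [G.PreservesEpimorphisms]
    (h : IsSyzygyFinite A) : IsSyzygyFinite B := by
  obtain ⟨s, hs⟩ := h
  obtain ⟨V, _, hV⟩ := hs.exists_isInAdd
  have := finite_map G hG V
  refine ⟨s + n, isRepresentationFinite_of_isInAdd (ModuleCat.of B (G.obj V × B)) ?_⟩
  rintro K ⟨t, X, ht, _, hK⟩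
  obtain ⟨m, rfl⟩ := Nat.exists_eq_add_of_le' (show n ≤ t by omega)
  obtain ⟨Y, hY, hYK⟩ := hK.exists_of_add
  have := hY.finite
  have := finite_map F hF.finite X
  have hFY : IsSyzygy A m (F.obj X) (F.obj Y) := hY.map F hF
  have hFYV : IsInAdd A (F.obj Y) V :=
    hV (F.obj Y) hFY.finite ⟨m, F.obj X, by omega, inferInstance, hFY⟩
  exact .of_stablyIsomorphic (hGF Y K inferInstance hYK) (hFYV.map G)

theorem IsIgusaTodorov.transfer [IsNoetherianRing B] [G.PreservesHomology]
    (h : IsIgusaTodorov A) : IsIgusaTodorov B := by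
  obtain ⟨V, m, _, hV⟩ := h
  have := finite_map G hG V
  refine ⟨ModuleCat.of B (G.obj V × B), m + n, inferInstanceAs (Module.Finite B (G.obj V × B)), ?_⟩
  intro X K _ hK
  obtain ⟨Y, hY, hYK⟩ := hK.exists_of_add
  have := hY.finite
  have hFY : HasShortAddResolution V (F.obj Y) :=
    hV (F.obj X) (F.obj Y) (finite_map F hF.finite X) (hY.map F hF)
  exact (hFY.map G).of_stablyIsomorphic (hGF Y K inferInstance hYK)

end Transfer

end Functors

theorem exists_splitting {R M M' M'' : Type*} [Ring R] [AddCommGroup M] [Module R M]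
    [AddCommGroup M'] [Module R M'] [AddCommGroup M''] [Module R M''] [Module.Projective R M'']
    {f : M →ₗ[R] M'} {g : M' →ₗ[R] M''} (hf : Function.Injective f) (hfg : Function.Exact f g)
    (hg : Function.Surjective g) :
    ∃ (s : M'' →ₗ[R] M') (t : M' →ₗ[R] M),
      t ∘ₗ f = LinearMap.id ∧ g ∘ₗ s = LinearMap.id ∧ f ∘ₗ t + s ∘ₗ g = LinearMap.id := by
  obtain ⟨s, hs⟩ := Module.projective_lifting_property g LinearMap.id hg
  obtain ⟨e, rfl, rfl⟩ := hfg.splitSurjectiveEquiv hf ⟨s, hs⟩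
  refine ⟨e.symm ∘ₗ LinearMap.inr R M M'', LinearMap.fst R M M'' ∘ₗ e, ?_, ?_, ?_⟩
  · ext; simp
  · ext; simp
  · ext x
    apply e.injective
    ext <;> simp

section TensorOver

variable {k : Type u} [Field k] {B : Type u} [Ring B] {M X : Type u}
  [AddCommGroup M] [Module k M] [Module Bᵐᵒᵖ M] [AddCommGroup X] [Module k X] [Module B X]

variable (k B M X) in
/-- The class of `m ⊗ x` in `M ⊗_B X`. -/
def TensorOver.tmul : M →+ X →+ TensorOver k B M X :=
  (balancedRel k B M X).mkQ.toAddMonoidHom.compHom.comp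
    (LinearMap.toAddMonoidHom'.comp (TensorProduct.mk k M X).toAddMonoidHom)

theorem TensorOver.op_smul_tmul (b : B) (m : M) (x : X) :
    tmul k B M X (MulOpposite.op b • m) x = tmul k B M X m (b • x) :=
  (Submodule.Quotient.eq _).2 (Submodule.subset_span ⟨b, m, x, rfl⟩)

@[elab_as_elim]
theorem TensorOver.induction_on {p : TensorOver k B M X → Prop} (t : TensorOver k B M X)
    (zero : p 0) (tmul : ∀ m x, p (tmul k B M X m x)) (add : ∀ s t, p s → p t → p (s + t)) :
    p t := by
  obtain ⟨t, rfl⟩ := Submodule.Quotient.mk_surjective _ t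
  induction t with
  | zero => exact zero
  | tmul m x => exact tmul m x
  | add s t hs ht => exact add _ _ hs ht

variable [Algebra k B] [IsScalarTower k Bᵐᵒᵖ M] [IsScalarTower k B X]
  {Z : Type*} [AddCommGroup Z]

theorem map_smul_eq_of_balanced (f : M →+ X →+ Z)
    (hf : ∀ (b : B) m x, f (MulOpposite.op b • m) x = f m (b • x)) (c : k) (m : M) (x : X) :
    f (c • m) x = f m (c • x) := by
  rw [← algebraMap_smul B c x, ← hf, ← algebraMap_smul Bᵐᵒᵖ c m]
  rfl

/-- The universal property of `M ⊗_B X`: it represents balanced biadditive maps. -/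
def TensorOver.lift (f : M →+ X →+ Z)
    (hf : ∀ (b : B) m x, f (MulOpposite.op b • m) x = f m (b • x)) :
    TensorOver k B M X →+ Z :=
  QuotientAddGroup.lift (balancedRel k B M X).toAddSubgroup
    (TensorProduct.liftAddHom f (map_smul_eq_of_balanced f hf)) <| by
      intro t ht
      induction ht using Submodule.closure_induction with
      | zero => exact zero_mem _
      | add s t _ _ hs ht => exact add_mem hs ht
      | smul_mem c t ht =>
        obtain ⟨b, m, x, rfl⟩ := ht
        rw [AddMonoidHom.mem_ker, smul_sub, TensorProduct.smul_tmul', TensorProduct.smul_tmul',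
          map_sub, TensorProduct.liftAddHom_tmul, TensorProduct.liftAddHom_tmul, smul_comm, hf,
          sub_self]

end TensorOver

/-- `M ⊗_B X` for a `B`-module `X`, on which `k` acts through `B`. -/
def BalancedTensor (k : Type u) [Field k] (B : Type u) [Ring B] [Algebra k B] (M X : Type u)
    [AddCommGroup M] [Module k M] [Module Bᵐᵒᵖ M] [AddCommGroup X] [Module B X] : Type u :=
  letI : Module k X := Module.compHom X (algebraMap k B)
  TensorOver k B M X

namespace BalancedTensor

variable (k : Type u) [Field k] {A B : Type u} [Ring A] [Algebra k A] [Ring B] [Algebra k B]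
  {M M' M'' : Type u} [AddCommGroup M] [Module k M] [Module A M] [Module Bᵐᵒᵖ M]
  [AddCommGroup M'] [Module k M'] [Module Bᵐᵒᵖ M'] [AddCommGroup M''] [Module k M'']
  [Module Bᵐᵒᵖ M''] {X Y W : Type u} [AddCommGroup X] [Module B X] [AddCommGroup Y] [Module B Y]
  [AddCommGroup W] [Module B W] {Z : Type*} [AddCommGroup Z]

theorem isScalarTower_compHom (X : Type u) [AddCommGroup X] [Module B X] :
    letI : Module k X := Module.compHom X (algebraMap k B)
    IsScalarTower k B X :=
  letI : Module k X := Module.compHom X (algebraMap k B)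
  .of_algebraMap_smul fun _ _ => rfl

instance : AddCommGroup (BalancedTensor k B M X) :=
  letI : Module k X := Module.compHom X (algebraMap k B)
  Submodule.Quotient.addCommGroup (balancedRel k B M X)

instance [IsScalarTower k A M] [SMulCommClass A Bᵐᵒᵖ M] : Module A (BalancedTensor k B M X) :=
  letI : Module k X := Module.compHom X (algebraMap k B)
  Module.compHom (TensorOver k B M X) (leftAction k A B M X).toRingHom

variable (B) in
/-- The class of `m ⊗ x` in `M ⊗_B X`. -/
def tmul : M →+ X →+ BalancedTensor k B M X :=
  letI : Module k X := Module.compHom X (algebraMap k B)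
  TensorOver.tmul k B M X

theorem op_smul_tmul (b : B) (m : M) (x : X) :
    tmul k B (MulOpposite.op b • m) x = tmul k B m (b • x) :=
  letI : Module k X := Module.compHom X (algebraMap k B)
  TensorOver.op_smul_tmul b m x

theorem smul_tmul [IsScalarTower k A M] [SMulCommClass A Bᵐᵒᵖ M] (a : A) (m : M) (x : X) :
    a • tmul k B m x = tmul k B (a • m) x :=
  rfl

@[elab_as_elim]
theorem induction_on {p : BalancedTensor k B M X → Prop} (t : BalancedTensor k B M X)
    (zero : p 0) (tmul : ∀ m x, p (tmul k B m x)) (add : ∀ s t, p s → p t → p (s + t)) : p t :=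
  letI : Module k X := Module.compHom X (algebraMap k B)
  TensorOver.induction_on (k := k) (B := B) (M := M) (X := X) t zero tmul add

variable {k} in
theorem addHom_ext {f g : BalancedTensor k B M X →+ Z}
    (h : ∀ m x, f (tmul k B m x) = g (tmul k B m x)) : f = g := by
  ext t
  induction t using induction_on with
  | zero => rw [map_zero, map_zero]
  | tmul m x => exact h m x
  | add s t hs ht => rw [map_add, map_add, hs, ht]

section Lift

variable [IsScalarTower k Bᵐᵒᵖ M]

/-- The universal property of `M ⊗_B X`: it represents balanced biadditive maps. -/
def lift (f : M →+ X →+ Z) (hf : ∀ (b : B) m x, f (MulOpposite.op b • m) x = f m (b • x)) :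
    BalancedTensor k B M X →+ Z :=
  letI : Module k X := Module.compHom X (algebraMap k B)
  haveI := isScalarTower_compHom k (B := B) X
  TensorOver.lift f hf

@[simp]
theorem lift_tmul (f : M →+ X →+ Z)
    (hf : ∀ (b : B) m x, f (MulOpposite.op b • m) x = f m (b • x)) (m : M) (x : X) :
    lift k f hf (tmul k B m x) = f m x :=
  rfl

end Lift

section Linear

variable [IsScalarTower k A M] [SMulCommClass A Bᵐᵒᵖ M] [Module A Z]

/-- An additive map on `M ⊗_B X` that is `A`-linear on pure tensors is `A`-linear. -/
def toLinear (f : BalancedTensor k B M X →+ Z)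
    (hf : ∀ (a : A) m x, f (tmul k B (a • m) x) = a • f (tmul k B m x)) :
    BalancedTensor k B M X →ₗ[A] Z where
  __ := f
  map_smul' a := DFunLike.congr_fun <| addHom_ext (f := f.comp (DistribSMul.toAddMonoidHom _ a))
    (g := (DistribSMul.toAddMonoidHom _ a).comp f) (hf a)

variable {k} in
theorem linearMap_ext {f g : BalancedTensor k B M X →ₗ[A] Z}
    (h : ∀ m x, f (tmul k B m x) = g (tmul k B m x)) : f = g :=
  LinearMap.toAddMonoidHom_injective (addHom_ext h)

end Linear

variable [IsScalarTower k Bᵐᵒᵖ M]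

/-- The additive map `g ⊗ f : M ⊗_B X → M' ⊗_B Y`. -/
def map (g : M →ₗ[Bᵐᵒᵖ] M') (f : X →ₗ[B] Y) :
    BalancedTensor k B M X →+ BalancedTensor k B M' Y :=
  lift k ((AddMonoidHom.compHom' f.toAddMonoidHom).comp ((tmul k B).comp g.toAddMonoidHom))
    fun b m x => by simp [op_smul_tmul]

@[simp]
theorem map_tmul (g : M →ₗ[Bᵐᵒᵖ] M') (f : X →ₗ[B] Y) (m : M) (x : X) :
    map k g f (tmul k B m x) = tmul k B (g m) (f x) :=
  rfl

theorem map_id_apply (t : BalancedTensor k B M X) :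
    map k (LinearMap.id : M →ₗ[Bᵐᵒᵖ] M) LinearMap.id t = t :=
  DFunLike.congr_fun (addHom_ext (f := map k LinearMap.id LinearMap.id) (g := .id _)
    fun _ _ => rfl) t

theorem map_map [IsScalarTower k Bᵐᵒᵖ M'] (g' : M' →ₗ[Bᵐᵒᵖ] M'') (g : M →ₗ[Bᵐᵒᵖ] M')
    (f' : Y →ₗ[B] W) (f : X →ₗ[B] Y) (t : BalancedTensor k B M X) :
    map k g' f' (map k g f t) = map k (g' ∘ₗ g) (f' ∘ₗ f) t :=
  DFunLike.congr_fun (addHom_ext (f := (map k g' f').comp (map k g f))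
    (g := map k (g' ∘ₗ g) (f' ∘ₗ f)) fun _ _ => rfl) t

theorem map_add_left (g g' : M →ₗ[Bᵐᵒᵖ] M') (f : X →ₗ[B] Y) (t : BalancedTensor k B M X) :
    map k (g + g') f t = map k g f t + map k g' f t :=
  DFunLike.congr_fun (addHom_ext (f := map k (g + g') f)
    (g := map k g f + map k g' f) fun m x => by simp) t

theorem map_zero_left (f : X →ₗ[B] Y) (t : BalancedTensor k B M X) :
    map k (0 : M →ₗ[Bᵐᵒᵖ] M') f t = 0 :=
  DFunLike.congr_fun (addHom_ext (f := map k 0 f) (g := 0) fun m x => by simp) t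

theorem map_zero_right (g : M →ₗ[Bᵐᵒᵖ] M') (t : BalancedTensor k B M X) :
    map k g (0 : X →ₗ[B] Y) t = 0 :=
  DFunLike.congr_fun (addHom_ext (f := map k g 0) (g := 0) fun m x => by simp) t

section Exact

/-- The coordinate map `m ⊗ x ↦ φ(m) x` on `M ⊗_B X` given by a right linear form `φ`. -/
def coord (φ : M →ₗ[Bᵐᵒᵖ] Bᵐᵒᵖ) (X : Type u) [AddCommGroup X] [Module B X] :
    BalancedTensor k B M X →+ X :=
  lift k (AddMonoidHom.smul.comp
    (MulOpposite.opAddEquiv.symm.toAddMonoidHom.comp φ.toAddMonoidHom))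
    fun b m x => by simp [mul_smul]

@[simp]
theorem coord_tmul (φ : M →ₗ[Bᵐᵒᵖ] Bᵐᵒᵖ) (m : M) (x : X) :
    coord k φ X (tmul k B m x) = (φ m).unop • x :=
  rfl

theorem coord_map (φ : M →ₗ[Bᵐᵒᵖ] Bᵐᵒᵖ) (f : X →ₗ[B] Y) (t : BalancedTensor k B M X) :
    coord k φ Y (map k LinearMap.id f t) = f (coord k φ X t) :=
  DFunLike.congr_fun (addHom_ext (f := (coord k φ Y).comp (map k LinearMap.id f))
    (g := f.toAddMonoidHom.comp (coord k φ X)) fun m x => by simp) t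

theorem sum_tmul_coord {ι : Type*} [Fintype ι] {φ : ι → M →ₗ[Bᵐᵒᵖ] Bᵐᵒᵖ}
    {p : ι → Bᵐᵒᵖ →ₗ[Bᵐᵒᵖ] M} (h : ∑ i, p i ∘ₗ φ i = LinearMap.id)
    (t : BalancedTensor k B M X) : ∑ i, tmul k B (p i 1) (coord k (φ i) X t) = t := by
  induction t using induction_on with
  | zero => simp
  | tmul m x =>
    have hi (i : ι) : tmul k B (p i 1) ((φ i m).unop • x) = tmul k B (p i (φ i m)) x := by
      rw [← op_smul_tmul, MulOpposite.op_unop, ← map_smul, smul_eq_mul, mul_one]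
    calc ∑ i, tmul k B (p i 1) (coord k (φ i) X (tmul k B m x))
        = tmul k B ((∑ i, p i ∘ₗ φ i) m) x := by simp [hi]
      _ = tmul k B m x := by rw [h, LinearMap.id_apply]
  | add s t hs ht => simp only [map_add, Finset.sum_add_distrib, hs, ht]

theorem exact_map_id_left [Module.Finite Bᵐᵒᵖ M] [Module.Projective Bᵐᵒᵖ M] {f : X →ₗ[B] Y}
    {g : Y →ₗ[B] W} (hfg : Function.Exact f g) :
    Function.Exact (map k (LinearMap.id : M →ₗ[Bᵐᵒᵖ] M) f)
      (map k (LinearMap.id : M →ₗ[Bᵐᵒᵖ] M) g) := by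
  obtain ⟨n, φ, p, h⟩ := (IsInAdd.of_projective (R := Bᵐᵒᵖ) (X := M)).exists_sum_comp_eq_id
  refine fun t => ⟨fun ht => ?_, ?_⟩
  · have hc (i : Fin n) : g (coord k (φ i) Y t) = 0 := by rw [← coord_map, ht, map_zero]
    choose v hv using fun i => (hfg _).1 (hc i)
    refine ⟨∑ i, tmul k B (p i 1) (v i), ?_⟩
    simp only [map_sum, map_tmul, hv, LinearMap.id_apply, sum_tmul_coord k h]
  · rintro ⟨t, rfl⟩
    rw [map_map, hfg.linearMap_comp_eq_zero, map_zero_right]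

/-- Splittings survive `- ⊗_B X` whether or not `X` is flat. -/
theorem exact_map_id_right [IsScalarTower k Bᵐᵒᵖ M'] [IsScalarTower k Bᵐᵒᵖ M'']
    [Module.Projective Bᵐᵒᵖ M''] {f : M →ₗ[Bᵐᵒᵖ] M'} {g : M' →ₗ[Bᵐᵒᵖ] M''}
    (hf : Function.Injective f) (hfg : Function.Exact f g) (hg : Function.Surjective g) :
    Function.Injective (map k f (LinearMap.id : X →ₗ[B] X)) ∧
      Function.Exact (map k f (LinearMap.id : X →ₗ[B] X)) (map k g LinearMap.id) ∧
      Function.Surjective (map k g (LinearMap.id : X →ₗ[B] X)) := by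
  obtain ⟨s, t, htf, hgs, hsum⟩ := exists_splitting hf hfg hg
  refine ⟨?_, fun x => ⟨fun hx => ⟨map k t LinearMap.id x, ?_⟩, ?_⟩, ?_⟩
  · refine Function.LeftInverse.injective (g := map k t LinearMap.id) fun x => ?_
    rw [map_map, htf, LinearMap.id_comp, map_id_apply]
  · have hsx : map k (s ∘ₗ g) LinearMap.id x = 0 := by
      rw [← LinearMap.id_comp (LinearMap.id : X →ₗ[B] X), ← map_map, hx, map_zero]
    calc map k f LinearMap.id (map k t LinearMap.id x)
        = map k (f ∘ₗ t + s ∘ₗ g) LinearMap.id x := by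
          rw [map_map, LinearMap.id_comp, map_add_left, hsx, add_zero]
      _ = x := by rw [hsum, map_id_apply]
  · rintro ⟨x, rfl⟩
    rw [map_map, hfg.linearMap_comp_eq_zero, map_zero_left]
  · refine Function.RightInverse.surjective (g := map k s LinearMap.id) fun x => ?_
    rw [map_map, hgs, LinearMap.id_comp, map_id_apply]

end Exact

end BalancedTensor

section TensorLeft

variable (k : Type u) [Field k] (A : Type u) {B : Type u} [Ring A] [Algebra k A] [Ring B]
  [Algebra k B] (M : Type u) [AddCommGroup M] [Module k M] [Module A M] [Module Bᵐᵒᵖ M]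
  [IsScalarTower k A M] [IsScalarTower k Bᵐᵒᵖ M] [SMulCommClass A Bᵐᵒᵖ M]

open BalancedTensor

/-- The functor `M ⊗_B -` from `B`-modules to `A`-modules given by an `A`-`B`-bimodule `M`. -/
def tensorLeft : ModuleCat.{u} B ⥤ ModuleCat.{u} A where
  obj X := ModuleCat.of A (BalancedTensor k B M X)
  map f := ModuleCat.ofHom (toLinear k (map k LinearMap.id f.hom) fun _ _ _ => rfl)
  map_id _ := ModuleCat.hom_ext (linearMap_ext fun _ _ => rfl)
  map_comp _ _ := ModuleCat.hom_ext (linearMap_ext fun _ _ => rfl)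

instance : (tensorLeft k A (B := B) M).Additive where
  map_add := ModuleCat.hom_ext (linearMap_ext fun m _ => (tmul k B m).map_add _ _)

instance [Module.Finite Bᵐᵒᵖ M] [Module.Projective Bᵐᵒᵖ M] :
    (tensorLeft k A (B := B) M).PreservesHomology := by
  have hS (S : ShortComplex (ModuleCat.{u} B)) (h : S.Exact) :
      (S.map (tensorLeft k A M)).Exact :=
    (ShortComplex.ShortExact.moduleCat_exact_iff_function_exact _).2 <| exact_map_id_left k <|
      (ShortComplex.ShortExact.moduleCat_exact_iff_function_exact S).1 h
  exact ((tensorLeft k A (B := B) M).exact_tfae.out 1 2).1 hS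

theorem isInAdd_tensorLeft_self [Module.Finite A M] [Module.Projective A M] :
    IsInAdd A ((tensorLeft k A M).obj (ModuleCat.of B B)) A := by
  let r : BalancedTensor k B M B →ₗ[A] M := toLinear k
    (lift k (AddMonoidHom.smul.comp MulOpposite.opAddEquiv.toAddMonoidHom).flip
      fun b m c => by simp [mul_smul]) fun a m b => by simp [smul_comm]
  let i : M →ₗ[A] BalancedTensor k B M B :=
    { toFun m := tmul k B m 1
      map_add' m m' := by simp
      map_smul' a m := rfl }
  refine IsInAdd.of_projective.of_isDirectSummand ⟨r, i, linearMap_ext fun m b => ?_⟩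
  change tmul k B (MulOpposite.op b • m) 1 = tmul k B m b
  rw [op_smul_tmul, smul_eq_mul, mul_one]

end TensorLeft

/-- A left `Aᵉ`-module `K`, viewed as an `A`-`A`-bimodule. -/
def EnvBimodule (k : Type u) [Field k] (A : Type u) [Ring A] [Algebra k A] (K : Type u) : Type u :=
  K

namespace EnvBimodule

open BalancedTensor

variable (k : Type u) [Field k] {A : Type u} [Ring A] [Algebra k A]
  {K L : Type u} [AddCommGroup K] [Module (Env k A) K] [AddCommGroup L] [Module (Env k A) L]

instance : AddCommGroup (EnvBimodule k A K) := ‹AddCommGroup K›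

instance : Module k (EnvBimodule k A K) := Module.compHom K (algebraMap k (Env k A))

instance : Module A (EnvBimodule k A K) :=
  Module.compHom K (Algebra.TensorProduct.includeLeft : A →ₐ[k] Env k A).toRingHom

instance : Module Aᵐᵒᵖ (EnvBimodule k A K) :=
  Module.compHom K (Algebra.TensorProduct.includeRight : Aᵐᵒᵖ →ₐ[k] Env k A).toRingHom

/-- The identity map from an `Aᵉ`-module to the corresponding bimodule. -/
def mk : K ≃+ EnvBimodule k A K := AddEquiv.refl K

theorem mk_smul (c : k) (x : K) : mk k (A := A) (algebraMap k (Env k A) c • x) = c • mk k x :=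
  rfl

theorem smul_mk (a : A) (x : K) :
    a • mk k (A := A) x = mk k ((a ⊗ₜ[k] (1 : Aᵐᵒᵖ) : Env k A) • x) :=
  rfl

theorem op_smul_mk (c : Aᵐᵒᵖ) (x : K) :
    c • mk k (A := A) x = mk k (((1 : A) ⊗ₜ[k] c : Env k A) • x) :=
  rfl

instance : IsScalarTower k A (EnvBimodule k A K) :=
  .of_algebraMap_smul fun _ _ => rfl

instance : IsScalarTower k Aᵐᵒᵖ (EnvBimodule k A K) :=
  .of_algebraMap_smul fun c x =>
    congrArg (fun e : Env k A => mk k (A := A) (e • (mk k (A := A)).symm x))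
      ((Algebra.TensorProduct.includeRight : Aᵐᵒᵖ →ₐ[k] Env k A).commutes c)

instance : SMulCommClass A Aᵐᵒᵖ (EnvBimodule k A K) where
  smul_comm a c x := by
    obtain ⟨x, rfl⟩ := (mk k (A := A)).surjective x
    simp only [op_smul_mk, smul_mk, smul_smul, Algebra.TensorProduct.tmul_mul_tmul, one_mul,
      mul_one]

/-- An `Aᵉ`-linear map as a map of right `A`-modules. -/
def rightMap (f : K →ₗ[Env k A] L) : EnvBimodule k A K →ₗ[Aᵐᵒᵖ] EnvBimodule k A L where
  toFun x := mk k (f ((mk k (A := A)).symm x))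
  map_add' := f.map_add
  map_smul' c := f.map_smul ((1 : A) ⊗ₜ[k] c)

variable (A) in
/-- The enveloping algebra is, as a right `A`-module, the free module `Aᵒᵖ ⊗ A`. -/
def envRightEquiv : (Aᵐᵒᵖ ⊗[k] A) ≃ₗ[Aᵐᵒᵖ] EnvBimodule k A (Env k A) where
  __ := (TensorProduct.comm k Aᵐᵒᵖ A).toAddEquiv.trans (mk k)
  map_smul' c t := by
    change mk k (TensorProduct.comm k Aᵐᵒᵖ A (c • t)) = c • mk k (TensorProduct.comm k Aᵐᵒᵖ A t)
    induction t with
    | zero => simp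
    | tmul a b => simp [op_smul_mk, TensorProduct.smul_tmul']
    | add s t hs ht => simp only [smul_add, map_add, hs, ht]

theorem projective_right [FiniteDimensional k A] (P : ModuleCat.{u} (Env k A))
    [Module.Finite (Env k A) P] [Module.Projective (Env k A) P] :
    Module.Projective Aᵐᵒᵖ (EnvBimodule k A P) := by
  have := Module.Finite.equiv (envRightEquiv k A)
  have := Module.Projective.of_equiv (envRightEquiv k A)
  have h : IsInAdd Aᵐᵒᵖ (EnvBimodule k A (Env k A)) Aᵐᵒᵖ := .of_projective
  exact (finite_and_projective_map (ModuleCat.restrictScalars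
    (Algebra.TensorProduct.includeRight : Aᵐᵒᵖ →ₐ[k] Env k A).toRingHom) h P).2

section TensorRight

variable (Y : Type u) [AddCommGroup Y] [Module A Y]

/-- The functor `- ⊗_A Y` from `A`-`A`-bimodules to `A`-modules. -/
def tensorRight : ModuleCat.{u} (Env k A) ⥤ ModuleCat.{u} A where
  obj K := ModuleCat.of A (BalancedTensor k A (EnvBimodule k A K) Y)
  map f := ModuleCat.ofHom <| toLinear k (map k (rightMap k f.hom) LinearMap.id) fun a m y =>
    congrArg (fun x => tmul k A (mk k x) y)
      (f.hom.map_smul (a ⊗ₜ[k] (1 : Aᵐᵒᵖ)) ((mk k (A := A)).symm m))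
  map_id _ := ModuleCat.hom_ext (linearMap_ext fun _ _ => rfl)
  map_comp _ _ := ModuleCat.hom_ext (linearMap_ext fun _ _ => rfl)

instance : (tensorRight k (A := A) Y).Additive where
  map_add {_ _ f g} := ModuleCat.hom_ext <| linearMap_ext fun m y =>
    DFunLike.congr_fun ((tmul k A).map_add (rightMap k f.hom m) (rightMap k g.hom m)) y

section Contract

variable {Y} [Module k Y] [IsScalarTower k A Y]

/-- The map `(a ⊗ c, y) ↦ ℓ(cy)a` for a `k`-linear form `ℓ` on `Y`. -/
def contractAux (ℓ : Y →ₗ[k] k) : Env k A →ₗ[k] Y →ₗ[k] A :=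
  TensorProduct.lift <| LinearMap.mk₂ k
    (fun a c => (ℓ ∘ₗ Algebra.lsmul k k Y (MulOpposite.unop c)).smulRight a)
    (fun _ _ _ => by ext; simp) (fun c _ _ => by ext; simp [smul_comm c])
    (fun _ _ _ => by ext; simp [add_smul]) (fun _ _ _ => by ext; simp [mul_smul])

theorem contractAux_tmul (ℓ : Y →ₗ[k] k) (a : A) (c : Aᵐᵒᵖ) (y : Y) :
    contractAux k ℓ (a ⊗ₜ c) y = ℓ (c.unop • y) • a :=
  rfl

theorem contractAux_op_smul (ℓ : Y →ₗ[k] k) (b : A) (e : Env k A) (y : Y) :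
    contractAux k ℓ (((1 : A) ⊗ₜ[k] MulOpposite.op b : Env k A) • e) y =
      contractAux k ℓ e (b • y) := by
  induction e using TensorProduct.induction_on with
  | zero => simp
  | tmul a c => simp [contractAux_tmul, mul_smul]
  | add s t hs ht => simp only [smul_add, map_add, LinearMap.add_apply, hs, ht]

theorem contractAux_smul (ℓ : Y →ₗ[k] k) (a : A) (e : Env k A) (y : Y) :
    contractAux k ℓ ((a ⊗ₜ[k] (1 : Aᵐᵒᵖ) : Env k A) • e) y = a • contractAux k ℓ e y := by
  induction e using TensorProduct.induction_on with
  | zero => simp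
  | tmul b c => simp [contractAux_tmul]
  | add s t hs ht => simp only [smul_add, map_add, LinearMap.add_apply, hs, ht]

/-- The map `Aᵉ ⊗_A Y → A`, `(a ⊗ c) ⊗ y ↦ ℓ(cy)a`, for a `k`-linear form `ℓ` on `Y`. -/
def contract (ℓ : Y →ₗ[k] k) : BalancedTensor k A (EnvBimodule k A (Env k A)) Y →ₗ[A] A :=
  toLinear k
    (lift k ((LinearMap.toAddMonoidHom'.comp (contractAux k ℓ).toAddMonoidHom).comp
      (mk k).symm.toAddMonoidHom) fun b m => contractAux_op_smul k ℓ b ((mk k).symm m))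
    fun a m => contractAux_smul k ℓ a ((mk k).symm m)

theorem contract_tmul (ℓ : Y →ₗ[k] k) (a : A) (c : Aᵐᵒᵖ) (y : Y) :
    contract k ℓ (tmul k A (mk k (a ⊗ₜ c)) y) = ℓ (c.unop • y) • a :=
  rfl

theorem sum_smul_tmul_contract {ι : Type*} [Fintype ι] (b : Module.Basis ι k Y)
    (t : BalancedTensor k A (EnvBimodule k A (Env k A)) Y) :
    ∑ i, contract k (b.coord i) t • tmul k A (mk k (1 : Env k A)) (b i) = t := by
  induction t using BalancedTensor.induction_on with
  | zero => simp
  | add s t hs ht => simp only [map_add, add_smul, Finset.sum_add_distrib, hs, ht]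
  | tmul m y =>
    obtain ⟨e, rfl⟩ := (mk k).surjective m
    induction e using TensorProduct.induction_on with
    | zero => simp
    | add s t hs ht =>
      simp only [map_add, AddMonoidHom.add_apply, add_smul, Finset.sum_add_distrib, hs, ht]
    | tmul a c =>
      have hi (i : ι) :
          contract k (b.coord i) (tmul k A (mk k (A := A) (a ⊗ₜ[k] c : Env k A)) y) •
              tmul k A (mk k (A := A) (1 : Env k A)) (b i) =
            tmul k A (mk k (A := A) (a ⊗ₜ[k] (1 : Aᵐᵒᵖ) : Env k A))
              (b.coord i (c.unop • y) • b i) := by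
        rw [← map_smul_eq_of_balanced (tmul k A) (op_smul_tmul k), contract_tmul, smul_tmul,
          smul_mk, smul_eq_mul, mul_one, ← TensorProduct.smul_tmul',
          ← algebraMap_smul (Env k A), mk_smul]
      simp only [hi, ← map_sum, Module.Basis.coord_apply, b.sum_repr]
      rw [← op_smul_tmul, MulOpposite.op_unop, op_smul_mk, smul_eq_mul,
        Algebra.TensorProduct.tmul_mul_tmul, one_mul, mul_one]

end Contract

theorem isInAdd_tensorRight_env [FiniteDimensional k A] [Module.Finite A Y] :
    IsInAdd A ((tensorRight k Y).obj (ModuleCat.of (Env k A) (Env k A))) A := by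
  let _ : Module k Y := Module.compHom Y (algebraMap k A)
  have : IsScalarTower k A Y := isScalarTower_compHom k Y
  have : Module.Finite k Y := .trans A Y
  let b := Module.finBasis k Y
  refine .of_sum_comp_eq_id (fun i => contract k (b.coord i))
    (fun i => LinearMap.toSpanSingleton A _ (tmul k A (mk k (1 : Env k A)) (b i))) ?_
  exact LinearMap.ext fun t =>
    (LinearMap.sum_apply _ _ _).trans (sum_smul_tmul_contract k b t)

end TensorRight

section Regular

variable {k}

/-- An isomorphism of bimodules `K ≅ A` as an additive isomorphism. -/
def evalRegular (e : K ≃ₗ[Env k A] regularBimodule k A) : EnvBimodule k A K ≃+ A :=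
  (mk k (A := A)).symm.trans e.toAddEquiv

theorem evalRegular_smul (e : K ≃ₗ[Env k A] regularBimodule k A) (a : A)
    (x : EnvBimodule k A K) :
    evalRegular e (a • x) = a * evalRegular e x := by
  let _ : Module (Env k A) A := TensorProduct.Algebra.module
  calc evalRegular e (a • x) = (a ⊗ₜ[k] (1 : Aᵐᵒᵖ) : Env k A) • evalRegular e x :=
        e.map_smul _ ((mk k (A := A)).symm x)
    _ = a * evalRegular e x := by rw [TensorProduct.Algebra.smul_def, one_smul, smul_eq_mul]

theorem evalRegular_op_smul (e : K ≃ₗ[Env k A] regularBimodule k A) (c : Aᵐᵒᵖ)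
    (x : EnvBimodule k A K) :
    evalRegular e (c • x) = evalRegular e x * c.unop := by
  let _ : Module (Env k A) A := TensorProduct.Algebra.module
  calc evalRegular e (c • x) = ((1 : A) ⊗ₜ[k] c : Env k A) • evalRegular e x :=
        e.map_smul _ ((mk k (A := A)).symm x)
    _ = evalRegular e x * c.unop := by rw [TensorProduct.Algebra.smul_def, one_smul]; rfl

/-- A bimodule isomorphic to `A` is free of rank one as a right module. -/
def rightEquivOfRegular (e : K ≃ₗ[Env k A] regularBimodule k A) :
    EnvBimodule k A K ≃ₗ[Aᵐᵒᵖ] Aᵐᵒᵖ where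
  __ := (evalRegular e).trans MulOpposite.opAddEquiv
  map_smul' c x := congrArg MulOpposite.op (evalRegular_op_smul e c x)

theorem nonempty_tensor_equiv_of_regular (e : K ≃ₗ[Env k A] regularBimodule k A)
    (Y : Type u) [AddCommGroup Y] [Module A Y] :
    Nonempty (BalancedTensor k A (EnvBimodule k A K) Y ≃ₗ[A] Y) := by
  let f : BalancedTensor k A (EnvBimodule k A K) Y →ₗ[A] Y :=
    toLinear k (lift k (AddMonoidHom.smul.comp (evalRegular e).toAddMonoidHom)
      fun b x y => by simp [evalRegular_op_smul, mul_smul])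
      fun a x y => by simp [evalRegular_smul, mul_smul]
  let g : Y →+ BalancedTensor k A (EnvBimodule k A K) Y := tmul k A ((evalRegular e).symm 1)
  have hgf : g.comp f.toAddMonoidHom = .id _ := addHom_ext fun x y => by
    have hx : MulOpposite.op (evalRegular e x) • (evalRegular e).symm 1 = x :=
      (evalRegular e).injective (by simp [evalRegular_op_smul])
    change tmul k A ((evalRegular e).symm 1) (evalRegular e x • y) = tmul k A x y
    rw [← op_smul_tmul, hx]
  have hfg (y : Y) : f (g y) = y := by
    change evalRegular e ((evalRegular e).symm 1) • y = y
    rw [AddEquiv.apply_symm_apply, one_smul]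
  exact ⟨{ f with invFun := g, left_inv := DFunLike.congr_fun hgf, right_inv := hfg }⟩

end Regular

theorem isSyzygy_tensorRight [FiniteDimensional k A] (Y : ModuleCat.{u} A) [Module.Finite A Y]
    {n : ℕ} {K : ModuleCat.{u} (Env k A)} (h : IsSyzygy (Env k A) n (regularBimodule k A) K) :
    Module.Projective Aᵐᵒᵖ (EnvBimodule k A K) ∧ IsSyzygy A n Y ((tensorRight k Y).obj K) := by
  induction n generalizing K with
  | zero =>
    obtain ⟨e⟩ := h
    exact ⟨.of_equiv (rightEquivOfRegular e).symm, nonempty_tensor_equiv_of_regular e Y⟩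
  | succ n ih =>
    obtain ⟨Z, P, f, g, hZ, _, _, hf, hfg, hg⟩ := h
    obtain ⟨_, hZY⟩ := ih hZ
    obtain ⟨hP, hP'⟩ := finite_and_projective_map (tensorRight k Y) (isInAdd_tensorRight_env k Y) P
    have := projective_right k P
    change Function.Injective (rightMap k f) at hf
    change Function.Exact (rightMap k f) (rightMap k g) at hfg
    change Function.Surjective (rightMap k g) at hg
    obtain ⟨hf', hfg', hg'⟩ := exact_map_id_right k (X := Y) hf hfg hg
    obtain ⟨-, t, htf, -⟩ := exists_splitting hf hfg hg
    exact ⟨.of_split (rightMap k f) t htf, _, _, mapLinear (tensorRight k Y) f,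
      mapLinear (tensorRight k Y) g, hZY, hP, hP', hf', hfg', hg'⟩

end EnvBimodule

section Assoc

open BalancedTensor

variable (k : Type u) [Field k] (A B : Type u) [Ring A] [Algebra k A] [Ring B] [Algebra k B]
  (M N : Type u)
  [AddCommGroup M] [Module k M] [Module A M] [Module Bᵐᵒᵖ M]
  [IsScalarTower k A M] [IsScalarTower k Bᵐᵒᵖ M] [SMulCommClass A Bᵐᵒᵖ M]
  [AddCommGroup N] [Module k N] [Module B N] [Module Aᵐᵒᵖ N]
  [IsScalarTower k B N] [IsScalarTower k Aᵐᵒᵖ N] [SMulCommClass B Aᵐᵒᵖ N]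

namespace tensorBimodule

/-- The class of `n ⊗ m` in the bimodule `N ⊗_A M`. -/
def tmul : N →+ M →+ EnvBimodule k B (tensorBimodule k B A N M) :=
  TensorOver.tmul k A N M

theorem op_smul_tmul (a : A) (n : N) (m : M) :
    tmul k A B M N (MulOpposite.op a • n) m = tmul k A B M N n (a • m) :=
  TensorOver.op_smul_tmul a n m

theorem smul_tmul (b : B) (n : N) (m : M) :
    b • tmul k A B M N n m = tmul k A B M N (b • n) m := by
  refine (tensorOverModule_smul k B A B N M b 1 n m).trans ?_
  rw [MulOpposite.op_one, one_smul]
  rfl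

theorem smul_op_tmul (b : B) (n : N) (m : M) :
    MulOpposite.op b • tmul k A B M N n m = tmul k A B M N n (MulOpposite.op b • m) := by
  refine (tensorOverModule_smul k B A B N M 1 b n m).trans ?_
  rw [one_smul]
  rfl

variable {k A B M N} in
@[elab_as_elim]
theorem induction_on {p : EnvBimodule k B (tensorBimodule k B A N M) → Prop}
    (t : EnvBimodule k B (tensorBimodule k B A N M))
    (zero : p 0) (tmul : ∀ n m, p (tmul k A B M N n m)) (add : ∀ s t, p s → p t → p (s + t)) :
    p t :=
  TensorOver.induction_on (k := k) (B := A) (M := N) (X := M) t zero tmul add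

variable (Y : Type u) [AddCommGroup Y] [Module B Y]

/-- The map `n ↦ (m ⊗ y ↦ (n ⊗ m) ⊗ y)`. -/
def assocAux : N →+ BalancedTensor k B M Y →+
    BalancedTensor k B (EnvBimodule k B (tensorBimodule k B A N M)) Y :=
  AddMonoidHom.mk' (fun n => lift k ((BalancedTensor.tmul k B).comp (tmul k A B M N n))
      fun b m y => by
        simp only [AddMonoidHom.comp_apply, ← smul_op_tmul, BalancedTensor.op_smul_tmul])
    fun n n' => addHom_ext fun m y => by simp

theorem assocAux_tmul (n : N) (m : M) (y : Y) :
    assocAux k A B M N Y n (BalancedTensor.tmul k B m y) =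
      BalancedTensor.tmul k B (tmul k A B M N n m) y :=
  rfl

/-- The map `N ⊗_A (M ⊗_B Y) → (N ⊗_A M) ⊗_B Y`. -/
def assocHom : BalancedTensor k A N (BalancedTensor k B M Y) →ₗ[B]
    BalancedTensor k B (EnvBimodule k B (tensorBimodule k B A N M)) Y :=
  toLinear k
    (lift k (assocAux k A B M N Y) fun a n t => by
      induction t using BalancedTensor.induction_on with
      | zero => simp
      | tmul m y =>
        rw [BalancedTensor.smul_tmul, assocAux_tmul, assocAux_tmul, op_smul_tmul]
      | add s t hs ht => rw [smul_add, map_add, map_add, hs, ht])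
    fun b n t => by
      rw [lift_tmul, lift_tmul]
      induction t using BalancedTensor.induction_on with
      | zero => simp
      | tmul m y => rw [assocAux_tmul, assocAux_tmul, BalancedTensor.smul_tmul, smul_tmul]
      | add s t hs ht => rw [map_add, map_add, hs, ht, smul_add]

/-- The map `n ⊗ m ↦ (y ↦ n ⊗ (m ⊗ y))`. -/
def assocInvAux : EnvBimodule k B (tensorBimodule k B A N M) →+
    Y →+ BalancedTensor k A N (BalancedTensor k B M Y) :=
  TensorOver.lift (k := k) (B := A) (M := N) (X := M)
    ((AddMonoidHom.compHom' (BalancedTensor.tmul k B)).comp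
      (AddMonoidHom.compHom.comp (BalancedTensor.tmul k A)))
    fun a n m => by
      ext y
      exact BalancedTensor.op_smul_tmul k a n (BalancedTensor.tmul k B m y)

theorem assocInvAux_tmul (n : N) (m : M) (y : Y) :
    assocInvAux k A B M N Y (tmul k A B M N n m) y =
      BalancedTensor.tmul k A n (BalancedTensor.tmul k B m y) :=
  rfl

/-- The map `(N ⊗_A M) ⊗_B Y → N ⊗_A (M ⊗_B Y)`. -/
def assocInv : BalancedTensor k B (EnvBimodule k B (tensorBimodule k B A N M)) Y →+
    BalancedTensor k A N (BalancedTensor k B M Y) :=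
  lift k (assocInvAux k A B M N Y) fun b t y => by
    induction t using tensorBimodule.induction_on with
    | zero => simp
    | tmul n m =>
      rw [smul_op_tmul, assocInvAux_tmul, assocInvAux_tmul, BalancedTensor.op_smul_tmul]
    | add s t hs ht => simp only [smul_add, map_add, AddMonoidHom.add_apply, hs, ht]

theorem assocInv_assocHom (t : BalancedTensor k A N (BalancedTensor k B M Y)) :
    assocInv k A B M N Y (assocHom k A B M N Y t) = t := by
  induction t using BalancedTensor.induction_on with
  | zero => simp
  | tmul n t =>
    induction t using BalancedTensor.induction_on with
    | zero => simp
    | tmul m y => rfl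
    | add s t hs ht => simp only [map_add, hs, ht]
  | add s t hs ht => simp only [map_add, hs, ht]

theorem assocHom_assocInv
    (t : BalancedTensor k B (EnvBimodule k B (tensorBimodule k B A N M)) Y) :
    assocHom k A B M N Y (assocInv k A B M N Y t) = t := by
  induction t using BalancedTensor.induction_on with
  | zero => simp
  | tmul t y =>
    induction t using tensorBimodule.induction_on with
    | zero => simp
    | tmul n m => rfl
    | add s t hs ht => simp only [map_add, AddMonoidHom.add_apply, hs, ht]
  | add s t hs ht => simp only [map_add, hs, ht]

/-- Associativity of the tensor product, `N ⊗_A (M ⊗_B Y) ≅ (N ⊗_A M) ⊗_B Y`. -/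
def assocEquiv : BalancedTensor k A N (BalancedTensor k B M Y) ≃ₗ[B]
    BalancedTensor k B (EnvBimodule k B (tensorBimodule k B A N M)) Y where
  __ := assocHom k A B M N Y
  invFun := assocInv k A B M N Y
  left_inv := assocInv_assocHom k A B M N Y
  right_inv := assocHom_assocInv k A B M N Y

end tensorBimodule

end Assoc

namespace IsSingularEquivalence

variable {k : Type u} [Field k] {A B : Type u} [Ring A] [Algebra k A]
  [Ring B] [Algebra k B] {M N : Type u}
  [AddCommGroup M] [Module k M] [Module A M] [Module Bᵐᵒᵖ M]
  [IsScalarTower k A M] [IsScalarTower k Bᵐᵒᵖ M] [SMulCommClass A Bᵐᵒᵖ M]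
  [AddCommGroup N] [Module k N] [Module B N] [Module Aᵐᵒᵖ N]
  [IsScalarTower k B N] [IsScalarTower k Aᵐᵒᵖ N] [SMulCommClass B Aᵐᵒᵖ N] {n : ℕ}

theorem symm (h : IsSingularEquivalence k A B M N n) : IsSingularEquivalence k B A N M n where
  finite_left_M := h.finite_left_N
  projective_left_M := h.projective_left_N
  finite_right_M := h.finite_right_N
  projective_right_M := h.projective_right_N
  finite_left_N := h.finite_left_M
  projective_left_N := h.projective_left_M
  finite_right_N := h.finite_right_M
  projective_right_N := h.projective_right_M
  tensor_MN := h.tensor_NM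
  tensor_NM := h.tensor_MN

variable [FiniteDimensional k B]

theorem stablyIsomorphic_tensorLeft_tensorLeft (h : IsSingularEquivalence k A B M N n)
    (Y K : ModuleCat.{u} B) [Module.Finite B Y] (hK : IsSyzygy B n Y K) :
    StablyIsomorphic B ((tensorLeft k B N).obj ((tensorLeft k A M).obj Y)) K := by
  obtain ⟨L, hL, hNM⟩ := h.tensor_NM
  have hassoc : StablyIsomorphic B ((tensorLeft k B N).obj ((tensorLeft k A M).obj Y))
      ((EnvBimodule.tensorRight k Y).obj (tensorBimodule k B A N M)) :=
    .of_equiv (tensorBimodule.assocEquiv k A B M N Y)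
  have hNM' : StablyIsomorphic B ((EnvBimodule.tensorRight k Y).obj (tensorBimodule k B A N M))
      ((EnvBimodule.tensorRight k Y).obj L) :=
    hNM.map (EnvBimodule.tensorRight k Y) (EnvBimodule.isInAdd_tensorRight_env k Y)
  have hLK : StablyIsomorphic B ((EnvBimodule.tensorRight k Y).obj L) K :=
    (EnvBimodule.isSyzygy_tensorRight k Y hL).2.stablyIsomorphic
      (.of_equiv (LinearEquiv.refl B Y)) hK
  exact (hassoc.trans hNM').trans hLK

theorem isSyzygyFinite [FiniteDimensional k A] (h : IsSingularEquivalence k A B M N n)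
    (hA : IsSyzygyFinite A) : IsSyzygyFinite B := by
  have : IsArtinianRing A := .of_finite k A
  have : IsArtinianRing B := .of_finite k B
  obtain ⟨_, _, _, _, _, _, _, _, -, -⟩ := id h
  exact hA.transfer (isInAdd_tensorLeft_self k A M) (isInAdd_tensorLeft_self k B N).finite
    fun Y K _ => h.stablyIsomorphic_tensorLeft_tensorLeft Y K

theorem isIgusaTodorov (h : IsSingularEquivalence k A B M N n)
    (hA : IsIgusaTodorov A) : IsIgusaTodorov B := by
  have : IsNoetherianRing B := .of_finite k B
  obtain ⟨_, _, _, _, _, _, _, _, -, -⟩ := id h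
  exact hA.transfer (isInAdd_tensorLeft_self k A M) (isInAdd_tensorLeft_self k B N).finite
    fun Y K _ => h.stablyIsomorphic_tensorLeft_tensorLeft Y K

end IsSingularEquivalence

end SingularMorita

theorem proposition5p1 (k : Type u) [Field k] (A B : Type u)
    [Ring A] [Algebra k A] [FiniteDimensional k A]
    [Ring B] [Algebra k B] [FiniteDimensional k B]
    (h : SingularMorita.SingularlyEquivalent k A B) :
    (SingularMorita.IsSyzygyFinite A ↔ SingularMorita.IsSyzygyFinite B) ∧
    (SingularMorita.IsIgusaTodorov A ↔ SingularMorita.IsIgusaTodorov B) := by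
  obtain ⟨n, M, _, _, _, _, _, _, _, N, _, _, _, _, _, _, _, h⟩ := h
  exact ⟨⟨h.isSyzygyFinite, h.symm.isSyzygyFinite⟩, ⟨h.isIgusaTodorov, h.symm.isIgusaTodorov⟩⟩
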